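/- **Naji's Theorem.** A *chord diagram* is a circle together with finitely many chords (straight line segments joining two distinct points of the circle), no two of which share an end. A *circle graph* is a graph that is the intersection graph of the chords of some chord diagram: its vertices correspond bijectively to the chords, and two distinct vertices are adjacent if and only if the corresponding chords intersect. Let $G$ be a finite simple graph. Then $G$ is a circle graph if and only if there exist values $\beta(u,v)\in\mathbb{F}_2$, one for each ordered pair $(u,v)$ of distinct vertices of $G$, such that 1. $\beta(v,w)+\beta(w,v)=1$ for each edge $vw$; 2. $\beta(x,v)+\beta(x,w)=0$ for each triple $(x,v,w)$ of distinct vertices such that $vw$ is an edge but $xv$ and $xw$ are not; and 3. $\beta(v,w)+\beta(w,v)+\beta(x,v)+\beta(x,w)=1$ for each triple $(x,v,w)$ of distinct vertices such that $xv$ and $xw$ are edges but $vw$ is not. -/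

import Mathlib

/-- A chord diagram whose chords are labelled by `V`: the chord with label `v` joins the points
`fst v` and `snd v` of the unit circle, and all the ends of all the chords are distinct. -/
structure ChordDiagram (V : Type*) where
  /-- one end of each chord -/
  fst : V → Circle
  /-- the other end of each chord -/
  snd : V → Circle
  fst_injective : Function.Injective fst
  snd_injective : Function.Injective snd
  fst_ne_snd : ∀ v w : V, fst v ≠ snd w

namespace ChordDiagram

/-- The chord with label `v`, as a closed line segment in the plane. -/
def chord {V : Type*} (C : ChordDiagram V) (v : V) : Set ℂ :=
  segment ℝ (C.fst v : ℂ) (C.snd v : ℂ)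

/-- The intersection graph of the chords of a chord diagram: distinct labels are adjacent exactly
when their chords have a point in common. -/
def intersectionGraph {V : Type*} (C : ChordDiagram V) : SimpleGraph V where
  Adj v w := v ≠ w ∧ (C.chord v ∩ C.chord w).Nonempty
  symm := ⟨fun _ _ h => ⟨h.1.symm, Set.inter_comm _ _ ▸ h.2⟩⟩
  loopless := ⟨fun _ h => h.1 rfl⟩

end ChordDiagram

namespace SimpleGraph

/-- A circle graph is the intersection graph of the chords of some chord diagram. -/
def IsCircleGraph {V : Type*} (G : SimpleGraph V) : Prop :=
  ∃ C : ChordDiagram V, C.intersectionGraph = G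

/-- `β` satisfies the Naji system of `G`. The equations only involve the values of `β` at pairs of
distinct vertices, so the values `β v v` are irrelevant. -/
structure IsNajiSolution {V : Type*} (G : SimpleGraph V) (β : V → V → ZMod 2) : Prop where
  ns1 : ∀ v w : V, G.Adj v w → β v w + β w v = 1
  ns2 : ∀ x v w : V, x ≠ v → x ≠ w → v ≠ w → G.Adj v w → ¬ G.Adj x v → ¬ G.Adj x w →
    β x v + β x w = 0
  ns3 : ∀ x v w : V, x ≠ v → x ≠ w → v ≠ w → G.Adj x v → G.Adj x w → ¬ G.Adj v w →
    β v w + β w v + β x v + β x w = 1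

end SimpleGraph

/-! Ends of chords are read as points of the line closed up to a circle. For directed chords let
β(u,w) = 1 when the head of w lies left of u. The three Naji equations then say that each of two
crossing chords sees the other's head oppositely, that crossing chords missing a third lie on one
side of it, and that parallel chords cut by a third agree in direction exactly when one of them has
the other's head on its left. So circle graphs have solutions. For the converse, reversing chords
acts on solutions by `switch`. Two patterns of β cannot come from chords. One is a bad clique: four
pairwise adjacent vertices such that, once chords are reversed to make β(a,·) vanish on the other
three, β is a cyclic tournament on those three. The other is a bad star: three parallel chords
across y, each between the other two. If a bad clique exists, the remaining vertices fall into four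
classes according to which member of the clique they resemble, and two classes against the other two
form a cut of rank at most one (`IsBadClique.exists_isRankOneCut`). Local complementation at y turns
a bad star into a bad clique and keeps the rank of cuts. Both sides of such a cut have at least two
vertices, so each side with one marker vertex from the other is smaller. Both have drawings by
induction, which are glued in `exists_isDrawing_of_split`. A disconnected graph is drawn piece by
piece. If G is connected without bad patterns, more is true: β itself is realized. Delete a non-cut
vertex v, realize the rest, and reverse chords so that every β(w,v) = 1. The head of v must go left
of every chord. The absence of bad patterns provides such a point (`Realizes.exists_leftOf`), and
the same result after reversing v and its neighbours provides the tail. Connectedness then forces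
the remaining values β(v,w). -/

/-! ### Chords with ends on a line: sides and crossings. -/

/-- On the line closed up to a circle, `x` lies strictly to the left of the chord directed from `t`
to `h`. -/
def LeftOf (t h x : ℝ) : Prop :=
  (t < h ∧ (x < t ∨ h < x)) ∨ (h < t ∧ h < x ∧ x < t)

/-- The chord from `t'` to `h'` has its ends on different sides of the chord from `t` to `h`. -/
def Crosses (t h t' h' : ℝ) : Prop :=
  ¬ (LeftOf t h h' ↔ LeftOf t h t')

theorem leftOf_iff_pos (t h x : ℝ) : LeftOf t h x ↔ 0 < (x - t) * (x - h) * (h - t) := by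
  unfold LeftOf
  rcases lt_trichotomy t h with h1 | rfl | h1
  · have : 0 < h - t := by linarith
    rw [mul_pos_iff_of_pos_right this, mul_pos_iff]
    grind
  · simp
  · have : h - t < 0 := by linarith
    rw [mul_pos_iff]
    simp only [not_lt.2 this.le, and_false, false_or, this, and_true, mul_neg_iff]
    grind

theorem leftOf_swap {t h x : ℝ} (hn : [t, h, x].Nodup) : LeftOf h t x ↔ ¬ LeftOf t h x := by
  simp only [List.nodup_cons, List.mem_cons, not_or, List.not_mem_nil,
    not_false_eq_true, and_true, List.nodup_nil] at hn
  unfold LeftOf; grind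

theorem Crosses.leftOf_iff {a b c d : ℝ} (hn : [a, b, c, d].Nodup) (hx : Crosses a b c d) :
    LeftOf a b d ↔ ¬ LeftOf c d b := by
  simp only [List.nodup_cons, List.mem_cons, not_or, List.not_mem_nil,
    not_false_eq_true, and_true, List.nodup_nil] at hn
  unfold Crosses LeftOf at *; grind

theorem crosses_comm {a b c d : ℝ} (hn : [a, b, c, d].Nodup) :
    Crosses a b c d ↔ Crosses c d a b := by
  simp only [List.nodup_cons, List.mem_cons, not_or, List.not_mem_nil,
    not_false_eq_true, and_true, List.nodup_nil] at hn
  unfold Crosses LeftOf at *; grind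

/-- The geometric source of `ns2`. -/
theorem leftOf_iff_of_crosses {a b c d e f : ℝ}
    (h1 : Crosses c d e f) (h2 : ¬ Crosses a b c d) (h3 : ¬ Crosses a b e f) :
    LeftOf a b d ↔ LeftOf a b f := by
  unfold Crosses LeftOf at *; grind

/-- The geometric source of `ns3`: the last two chords run parallel across the first. They have the
same direction exactly when one of them has the other's head on its left and not conversely. -/
theorem leftOf_iff_iff_of_not_crosses {a b c d e f : ℝ} (hn : [a, b, c, d, e, f].Nodup)
    (h1 : ¬ Crosses c d e f) (h2 : Crosses a b c d) (h3 : Crosses a b e f) :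
    (LeftOf a b d ↔ LeftOf a b f) ↔ ¬ (LeftOf c d f ↔ LeftOf e f d) := by
  simp only [List.nodup_cons, List.mem_cons, not_or, List.not_mem_nil,
    not_false_eq_true, and_true, List.nodup_nil] at hn
  unfold Crosses LeftOf at *; grind (splits := 40)

/-! ### Drawings, their Naji solutions, and reversal of chords. -/

namespace SimpleGraph

variable {V : Type*} {G : SimpleGraph V} {S : Set V} {t h : V → ℝ} {β : V → V → ZMod 2}

/-- The directed chords from `t v` to `h v`, for `v ∈ S`, have distinct ends and their crossings are
the edges of `G` in `S`. -/
structure IsDrawing (G : SimpleGraph V) (S : Set V) (t h : V → ℝ) : Prop where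
  t_inj : ∀ u ∈ S, ∀ w ∈ S, u ≠ w → t u ≠ t w
  h_inj : ∀ u ∈ S, ∀ w ∈ S, u ≠ w → h u ≠ h w
  t_ne_h : ∀ u ∈ S, ∀ w ∈ S, t u ≠ h w
  adj_iff : ∀ u ∈ S, ∀ w ∈ S, u ≠ w → (G.Adj u w ↔ Crosses (t u) (h u) (t w) (h w))

/-- A drawing such that `β u w = 1` exactly when the head of `w` is to the left of `u`. -/
structure Realizes (G : SimpleGraph V) (β : V → V → ZMod 2) (S : Set V) (t h : V → ℝ) : Prop
    extends G.IsDrawing S t h where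
  eq_one_iff : ∀ u ∈ S, ∀ w ∈ S, u ≠ w → (β u w = 1 ↔ LeftOf (t u) (h u) (h w))

theorem IsDrawing.nodup_two (D : G.IsDrawing S t h) {u v : V} (hu : u ∈ S) (hv : v ∈ S)
    (huv : u ≠ v) : [t u, h u, t v, h v].Nodup := by
  have h1 := D.t_inj u hu v hv huv
  have h2 := D.h_inj u hu v hv huv
  have h3 := D.t_ne_h u hu v hv
  have h4 := D.t_ne_h v hv u hu
  have h5 := D.t_ne_h u hu u hu
  have h6 := D.t_ne_h v hv v hv
  simp [*, Ne.symm]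

theorem IsDrawing.nodup_three (D : G.IsDrawing S t h) {u v w : V} (hu : u ∈ S) (hv : v ∈ S)
    (hw : w ∈ S) (huv : u ≠ v) (huw : u ≠ w) (hvw : v ≠ w) :
    [t u, h u, t v, h v, t w, h w].Nodup := by
  have h1 := D.nodup_two hu hv huv
  have h2 := D.nodup_two hu hw huw
  have h3 := D.nodup_two hv hw hvw
  simp only [List.nodup_cons, List.mem_cons, not_or, List.not_mem_nil,
    not_false_eq_true, and_true, List.nodup_nil] at *
  tauto

theorem IsDrawing.exists_isNajiSolution (D : G.IsDrawing Set.univ t h) :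
    ∃ β : V → V → ZMod 2, G.IsNajiSolution β ∧ G.Realizes β Set.univ t h := by
  classical
  have key (p : Prop) [Decidable p] : (if p then (1 : ZMod 2) else 0) = 1 ↔ p := by
    split_ifs <;> simp [*]
  refine ⟨fun u w => if LeftOf (t u) (h u) (h w) then 1 else 0, ⟨?_, ?_, ?_⟩, ⟨D, ?_⟩⟩
  · intro v w hvw
    have := ((D.adj_iff v trivial w trivial hvw.ne).1 hvw).leftOf_iff
      (D.nodup_two trivial trivial hvw.ne)
    simp only [this]
    split_ifs <;> simp_all
  · intro x v w hxv hxw hvw h1 h2 h3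
    rw [D.adj_iff _ trivial _ trivial (by assumption)] at h1 h2 h3
    have := leftOf_iff_of_crosses h1 h2 h3
    simp only [this]
    split_ifs <;> decide
  · intro x v w hxv hxw hvw h1 h2 h3
    rw [D.adj_iff _ trivial _ trivial (by assumption)] at h1 h2 h3
    have := leftOf_iff_iff_of_not_crosses
      (D.nodup_three (u := x) (v := v) (w := w) trivial trivial trivial hxv hxw hvw) h3 h1 h2
    split_ifs <;> first | decide | (exfalso; tauto)
  · intro u _ w _ _
    exact key _

/-- Reversal of the chords in the support of `ρ`. -/
def switch (G : SimpleGraph V) [DecidableRel G.Adj] (ρ : V → ZMod 2) (β : V → V → ZMod 2)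
    (u w : V) : ZMod 2 :=
  β u w + ρ u + if G.Adj u w then ρ w else 0

theorem IsNajiSolution.switch [DecidableRel G.Adj] (hβ : G.IsNajiSolution β) (ρ : V → ZMod 2) :
    G.IsNajiSolution (G.switch ρ β) := by
  refine ⟨?_, ?_, ?_⟩
  · intro v w h1
    have := hβ.ns1 v w h1
    simp only [SimpleGraph.switch, h1, h1.symm, if_true]
    grind
  · intro x v w hxv hxw hvw h1 h2 h3
    have := hβ.ns2 x v w hxv hxw hvw h1 h2 h3
    simp only [SimpleGraph.switch, h2, h3, if_false]
    grind
  · intro x v w hxv hxw hvw h1 h2 h3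
    have := hβ.ns3 x v w hxv hxw hvw h1 h2 h3
    have h3' : ¬ G.Adj w v := fun h => h3 h.symm
    simp only [SimpleGraph.switch, h1, h2, h3, h3', if_false, if_true]
    grind

theorem Realizes.of_switch [DecidableRel G.Adj] {ρ : V → ZMod 2}
    (hD : G.Realizes (G.switch ρ β) S t h) :
    G.Realizes β S (fun v => if ρ v = 0 then t v else h v)
      (fun v => if ρ v = 0 then h v else t v) := by
  have hρ : ∀ v, ρ v = 0 ∨ ρ v = 1 := fun v => by
    have : ∀ a : ZMod 2, a = 0 ∨ a = 1 := by decide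
    exact this _
  have hb : ∀ v w, β v w = 0 ∨ β v w = 1 := fun v w => by
    have : ∀ a : ZMod 2, a = 0 ∨ a = 1 := by decide
    exact this _
  have hs : ∀ u ∈ S, ∀ w ∈ S, u ≠ w → (LeftOf (h u) (t u) (h w) ↔ ¬ LeftOf (t u) (h u) (h w)) ∧
      (LeftOf (h u) (t u) (t w) ↔ ¬ LeftOf (t u) (h u) (t w)) := by
    intro u hu w hw huw
    have := hD.nodup_two hu hw huw
    simp only [List.nodup_cons, List.mem_cons, not_or, List.not_mem_nil,
      not_false_eq_true, and_true, List.nodup_nil] at this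
    constructor <;> apply leftOf_swap <;> simp <;> grind
  refine ⟨⟨?_, ?_, ?_, ?_⟩, ?_⟩
  · intro u hu w hw huw
    have h1 := hD.t_inj u hu w hw huw
    have h2 := hD.h_inj u hu w hw huw
    have h3 := hD.t_ne_h u hu w hw
    have h4 := hD.t_ne_h w hw u hu
    rcases hρ u with h | h <;> rcases hρ w with h' | h' <;> simp_all [Ne.symm]
  · intro u hu w hw huw
    have h1 := hD.t_inj u hu w hw huw
    have h2 := hD.h_inj u hu w hw huw
    have h3 := hD.t_ne_h u hu w hw
    have h4 := hD.t_ne_h w hw u hu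
    rcases hρ u with h | h <;> rcases hρ w with h' | h' <;> simp_all [Ne.symm]
  · intro u hu w hw
    have h3 := hD.t_ne_h u hu w hw
    have h4 := hD.t_ne_h w hw u hu
    by_cases huw : u = w
    · subst huw
      rcases hρ u with h | h <;> simp_all [Ne.symm]
    have h1 := hD.t_inj u hu w hw huw
    have h2 := hD.h_inj u hu w hw huw
    rcases hρ u with h | h <;> rcases hρ w with h' | h' <;> simp_all [Ne.symm]
  · intro u hu w hw huw
    obtain ⟨e1, e2⟩ := hs u hu w hw huw
    rw [hD.adj_iff u hu w hw huw]
    unfold Crosses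
    rcases hρ u with h | h <;> rcases hρ w with h' | h' <;>
      simp only [h, h', if_true, if_false, one_ne_zero] <;> tauto
  · intro u hu w hw huw
    obtain ⟨e1, e2⟩ := hs u hu w hw huw
    have e3 := hD.eq_one_iff u hu w hw huw
    have e4 := hD.adj_iff u hu w hw huw
    unfold Crosses at e4
    unfold SimpleGraph.switch at e3
    have e5 : (0 : ZMod 2) ≠ 1 := by decide
    have e6 : (1 : ZMod 2) + 1 = 0 := by decide
    by_cases h5 : G.Adj u w <;>
    rcases hρ u with h | h <;> rcases hρ w with h' | h' <;> rcases hb u w with h2 | h2 <;>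
      simp only [h, h', h2, h5, if_true, if_false, one_ne_zero, add_zero, zero_add, e6, e5,
        true_iff, false_iff, not_false_eq_true] at * <;> grind

end SimpleGraph

/-! ### From chords of the unit circle to pairs of reals and back. -/

namespace ChordDiagram

/-- The determinant of `b - a` and `c - a`: its sign is the orientation of the triangle `a b c`. -/
def orient (a b c : ℂ) : ℝ :=
  (b.re - a.re) * (c.im - a.im) - (b.im - a.im) * (c.re - a.re)

theorem disjoint_segment {a b c d : ℂ} (h : 0 < orient a b c * orient a b d) :
    ¬ (segment ℝ a b ∩ segment ℝ c d).Nonempty := by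
  rintro ⟨z, ⟨r, s, hr, hs, hrs, rfl⟩, ⟨p, q, hp, hq, hpq, hz⟩⟩
  have h0 : orient a b (r • a + s • b) = 0 := by
    obtain rfl : r = 1 - s := by linarith
    simp only [orient, Complex.add_re, Complex.add_im, Complex.real_smul, Complex.re_ofReal_mul,
      Complex.im_ofReal_mul]
    ring
  have h1 : orient a b (p • c + q • d) = p * orient a b c + q * orient a b d := by
    obtain rfl : p = 1 - q := by linarith
    simp only [orient, Complex.add_re, Complex.add_im, Complex.real_smul, Complex.re_ofReal_mul,
      Complex.im_ofReal_mul]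
    ring
  rw [← hz, h1] at h0
  have h2 : p * orient a b c ^ 2 + q * (orient a b c * orient a b d) = 0 := by
    linear_combination orient a b c * h0
  have h3 : 0 < orient a b c ^ 2 := by
    have : orient a b c ≠ 0 := by rintro h'; simp [h'] at h
    positivity
  rcases hp.lt_or_eq with hp | rfl
  · nlinarith [mul_pos hp h3, mul_nonneg hq h.le]
  · nlinarith [mul_nonneg hp h3.le]

theorem segment_inter_nonempty {a b c d : ℂ} (h : orient a b c * orient a b d < 0)
    (h' : orient c d a * orient c d b < 0) : (segment ℝ a b ∩ segment ℝ c d).Nonempty := by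
  -- The weights of the common point: a segment whose ends have signed heights `x` and `y` over a
  -- line meets it at parameter `x / (x - y)`.
  have frac : ∀ {x y : ℝ}, x * y < 0 → x - y ≠ 0 ∧ 0 ≤ x / (x - y) ∧ 0 ≤ -y / (x - y) := by
    intro x y hxy
    rcases mul_neg_iff.1 hxy with ⟨h1, h2⟩ | ⟨h1, h2⟩
    · exact ⟨by linarith, div_nonneg h1.le (by linarith), div_nonneg (by linarith) (by linarith)⟩
    · exact ⟨by linarith, div_nonneg_of_nonpos h1.le (by linarith),
        div_nonneg_of_nonpos (by linarith) (by linarith)⟩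
  obtain ⟨n1, p1, q1⟩ := frac h
  obtain ⟨n2, p2, q2⟩ := frac h'
  refine ⟨_, ⟨_, _, q2, p2, by rw [← add_div, ← sub_eq_neg_add, div_self n2], rfl⟩,
    ⟨_, _, q1, p1, by rw [← add_div, ← sub_eq_neg_add, div_self n1], ?_⟩⟩
  apply Complex.ext <;>
  · simp only [Complex.add_re, Complex.add_im, Complex.real_smul, Complex.re_ofReal_mul,
      Complex.im_ofReal_mul]
    field_simp
    simp only [orient]
    ring

theorem orient_mul (u a b c : ℂ) : orient (u * a) (u * b) (u * c) =
    Complex.normSq u * orient a b c := by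
  simp only [orient, Complex.mul_re, Complex.mul_im, Complex.normSq_apply]
  ring

/-- The stereographic parametrization of the unit circle without `-1`. -/
noncomputable def circlePoint (x : ℝ) : Circle :=
  ⟨⟨(1 - x ^ 2) / (1 + x ^ 2), 2 * x / (1 + x ^ 2)⟩, by
    have : 1 + x ^ 2 ≠ 0 := by positivity
    change _ ∈ Metric.sphere (0 : ℂ) 1
    rw [mem_sphere_zero_iff_norm, ← sq_eq_sq₀ (norm_nonneg _) zero_le_one,
      ← Complex.normSq_eq_norm_sq, Complex.normSq_apply]
    field_simp
    ring⟩

/-- Up to a positive factor this is the product of `leftOf_iff_pos`, so being left of a chord means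
the same on the line and on the circle. -/
theorem orient_circlePoint (a b c : ℝ) :
    orient (circlePoint a) (circlePoint b) (circlePoint c) =
      4 / ((1 + a ^ 2) * (1 + b ^ 2) * (1 + c ^ 2)) * ((c - a) * (c - b) * (b - a)) := by
  have h1 : 1 + a ^ 2 ≠ 0 := by positivity
  have h2 : 1 + b ^ 2 ≠ 0 := by positivity
  have h3 : 1 + c ^ 2 ≠ 0 := by positivity
  simp only [orient, circlePoint]
  field_simp
  ring

theorem exists_circlePoint_eq {z : Circle} (hz : (z : ℂ).re ≠ -1) : ∃ x, circlePoint x = z := by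
  have h1 : (z : ℂ).re ^ 2 + (z : ℂ).im ^ 2 = 1 := by
    have := Circle.normSq_coe z
    rw [Complex.normSq_apply] at this
    linarith
  have h0 : 1 + (z : ℂ).re ≠ 0 := fun h => hz (by linarith)
  refine ⟨(z : ℂ).im / (1 + (z : ℂ).re), ?_⟩
  have h2 : 1 + ((z : ℂ).im / (1 + (z : ℂ).re)) ^ 2 = 2 / (1 + (z : ℂ).re) := by
    field_simp
    linear_combination h1
  apply Circle.ext
  apply Complex.ext
  · simp only [circlePoint, h2]
    field_simp
    linear_combination -h1
  · simp only [circlePoint, h2]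
    field_simp

theorem circlePoint_injective : Function.Injective circlePoint := by
  intro a b hab
  have h := congrArg (fun z : Circle => (z : ℂ)) hab
  have hre := congrArg Complex.re h
  have him := congrArg Complex.im h
  have h1 : 1 + a ^ 2 ≠ 0 := by positivity
  have h2 : 1 + b ^ 2 ≠ 0 := by positivity
  simp only [circlePoint] at hre him
  have e1 : 1 / (1 + a ^ 2) = 1 / (1 + b ^ 2) := by
    have k : ∀ x : ℝ, 1 + x ^ 2 ≠ 0 → 1 / (1 + x ^ 2) = ((1 - x ^ 2) / (1 + x ^ 2) + 1) / 2 := by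
      intro x hx; field_simp; ring
    rw [k a h1, k b h2, hre]
  have e2 : 1 + a ^ 2 = 1 + b ^ 2 := by simpa using e1
  rw [e2] at him
  field_simp at him
  linarith

theorem orient_circlePoint_pos {a b c : ℝ} :
    0 < orient (circlePoint a) (circlePoint b) (circlePoint c) ↔ LeftOf a b c := by
  rw [orient_circlePoint, leftOf_iff_pos]
  exact mul_pos_iff_of_pos_left (by positivity)

theorem segment_circlePoint_inter {a b c d : ℝ} (hn : [a, b, c, d].Nodup) {u : ℂ} (hu : u ≠ 0) :
    (segment ℝ (u * circlePoint a) (u * circlePoint b) ∩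
      segment ℝ (u * circlePoint c) (u * circlePoint d)).Nonempty ↔ Crosses a b c d := by
  have hn' := hn
  simp only [List.nodup_cons, List.mem_cons, not_or, List.not_mem_nil,
    not_false_eq_true, and_true, List.nodup_nil] at hn'
  have hu' : 0 < Complex.normSq u := Complex.normSq_pos.2 hu
  have hne : ∀ {a b c : ℝ}, a ≠ b → a ≠ c → b ≠ c →
      orient (u * circlePoint a) (u * circlePoint b) (u * circlePoint c) ≠ 0 := by
    intro a b c h1 h2 h3
    rw [orient_mul, orient_circlePoint]
    have := sub_ne_zero.2 h1.symm
    have := sub_ne_zero.2 h2.symm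
    have := sub_ne_zero.2 h3.symm
    positivity
  have hpos : ∀ {a b c : ℝ}, 0 < orient (u * circlePoint a) (u * circlePoint b) (u * circlePoint c)
      ↔ LeftOf a b c := by
    intro a b c
    rw [orient_mul, mul_pos_iff_of_pos_left hu', orient_circlePoint_pos]
  have key : ∀ {a b c d : ℝ}, a ≠ b → a ≠ c → b ≠ c → a ≠ d → b ≠ d → (Crosses a b c d ↔
      orient (u * circlePoint a) (u * circlePoint b) (u * circlePoint c) *
      orient (u * circlePoint a) (u * circlePoint b) (u * circlePoint d) < 0) := by
    intro a b c d h1 h2 h3 h4 h5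
    have e1 := hne h1 h2 h3
    have e2 := hne h1 h4 h5
    unfold Crosses
    rw [← hpos, ← hpos, mul_neg_iff]
    rcases lt_or_gt_of_ne e1 with e1 | e1 <;> rcases lt_or_gt_of_ne e2 with e2 | e2 <;>
      simp [e1, e2, e1.not_gt, e2.not_gt]
  by_cases hx : Crosses a b c d
  · simp only [hx, iff_true]
    have hx' := (crosses_comm hn).1 hx
    rw [key (by tauto) (by tauto) (by tauto) (by tauto) (by tauto)] at hx
    rw [key (by tauto) (by grind) (by grind) (by grind) (by grind)] at hx'
    exact segment_inter_nonempty hx hx'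
  · simp only [hx, iff_false]
    rw [key (by tauto) (by tauto) (by tauto) (by tauto) (by tauto)] at hx
    refine disjoint_segment (lt_of_le_of_ne (not_lt.1 hx) (Ne.symm (mul_ne_zero ?_ ?_)))
    · exact hne (by tauto) (by tauto) (by tauto)
    · exact hne (by tauto) (by tauto) (by tauto)

end ChordDiagram

namespace SimpleGraph

open ChordDiagram

variable {V : Type*} {G : SimpleGraph V}

theorem IsDrawing.isCircleGraph {t h : V → ℝ} (D : G.IsDrawing Set.univ t h) :
    G.IsCircleGraph := by
  refine ⟨⟨fun v => circlePoint (t v), fun v => circlePoint (h v), ?_, ?_, ?_⟩, ?_⟩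
  · intro v w hvw
    by_contra hne
    exact D.t_inj v trivial w trivial hne (circlePoint_injective hvw)
  · intro v w hvw
    by_contra hne
    exact D.h_inj v trivial w trivial hne (circlePoint_injective hvw)
  · intro v w hvw
    exact D.t_ne_h v trivial w trivial (circlePoint_injective hvw)
  · ext v w
    by_cases hvw : v = w
    · subst hvw; simp
    rw [D.adj_iff v trivial w trivial hvw,
      ← segment_circlePoint_inter (D.nodup_two trivial trivial hvw) one_ne_zero]
    simp [intersectionGraph, chord, hvw]

theorem exists_isDrawing_of_isCircleGraph [Finite V] (hG : G.IsCircleGraph) :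
    ∃ t h : V → ℝ, G.IsDrawing Set.univ t h := by
  obtain ⟨C, rfl⟩ := hG
  -- `circlePoint` misses `-1`, so the circle is rotated by a `u` for which `-u` is not an end of
  -- any chord.
  obtain ⟨u, hu⟩ : ∃ u : Circle, u ∉ (Set.range (fun v => -C.fst v) ∪ Set.range fun v => -C.snd v)  := by
    have : Infinite Circle := Infinite.of_injective circlePoint circlePoint_injective
    exact ((Set.finite_range _).union (Set.finite_range _)).exists_notMem
  have hpt : ∀ z : Circle, u ≠ -z → ∃ x, u * circlePoint x = z := by
    intro z hz
    obtain ⟨x, hx⟩ : ∃ x, circlePoint x = u⁻¹ * z := by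
      refine exists_circlePoint_eq fun h => hz ?_
      have h1 := Circle.normSq_coe (u⁻¹ * z)
      rw [Complex.normSq_apply, h] at h1
      have h2 : u⁻¹ * z = -1 := by
        apply Circle.ext
        apply Complex.ext
        · simpa using h
        · have : ((u⁻¹ * z : Circle) : ℂ).im = 0 := by nlinarith
          simpa using this
      rw [inv_mul_eq_iff_eq_mul] at h2
      simp [h2]
    exact ⟨x, by rw [hx, mul_inv_cancel_left]⟩
  choose t ht using fun v => hpt (C.fst v) (by rintro rfl; simp at hu)
  choose h hh using fun v => hpt (C.snd v) (by rintro rfl; simp at hu)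
  have e1 : ∀ v w, v ≠ w → t v ≠ t w := by
    intro v w hvw e
    exact hvw (C.fst_injective (by rw [← ht, ← ht, e]))
  have e2 : ∀ v w, v ≠ w → h v ≠ h w := by
    intro v w hvw e
    exact hvw (C.snd_injective (by rw [← hh, ← hh, e]))
  have e3 : ∀ v w, t v ≠ h w := by
    intro v w e
    exact C.fst_ne_snd v w (by rw [← ht, ← hh, e])
  refine ⟨t, h, ⟨fun v _ w _ => e1 v w, fun v _ w _ => e2 v w, fun v _ w _ => e3 v w, ?_⟩⟩
  intro v _ w _ hvw
  have hn : [t v, h v, t w, h w].Nodup := by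
    have := e1 v w hvw
    have := e2 v w hvw
    have := e3 v w
    have := e3 w v
    have := e3 v v
    have := e3 w w
    simp [*, Ne.symm]
  rw [← segment_circlePoint_inter hn (Circle.coe_ne_zero u)]
  simp only [← Circle.coe_mul, ht, hh]
  simp [intersectionGraph, chord, hvw]

end SimpleGraph

/-! ### Changes of coordinate and gluing of drawings. -/

theorem leftOf_strictMono {f : ℝ → ℝ} (hf : StrictMono f) (t h x : ℝ) :
    LeftOf (f t) (f h) (f x) ↔ LeftOf t h x := by
  simp only [LeftOf, hf.lt_iff_lt]

/-- A Möbius map of positive determinant keeps the cyclic order: the product deciding the side is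
multiplied by a square. It rotates the closed-up line, sending `c` to infinity. -/
theorem leftOf_neg_inv_sub {c t h x : ℝ} (ht : t ≠ c) (hh : h ≠ c) (hx : x ≠ c) :
    LeftOf (-(t - c)⁻¹) (-(h - c)⁻¹) (-(x - c)⁻¹) ↔ LeftOf t h x := by
  rw [leftOf_iff_pos, leftOf_iff_pos]
  have h1 := sub_ne_zero.2 ht
  have h2 := sub_ne_zero.2 hh
  have h3 := sub_ne_zero.2 hx
  have : (-(x - c)⁻¹ - -(t - c)⁻¹) * (-(x - c)⁻¹ - -(h - c)⁻¹) * (-(h - c)⁻¹ - -(t - c)⁻¹) =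
      ((x - t) * (x - h) * (h - t)) * ((t - c)⁻¹ * (h - c)⁻¹ * (x - c)⁻¹) ^ 2 := by
    field_simp
    ring
  rw [this]
  exact mul_pos_iff_of_pos_right (by positivity)

theorem exists_lt_forall_notMem {E : Set ℝ} (hE : E.Finite) {a e : ℝ} (hae : a < e) :
    ∃ p, a < p ∧ p < e ∧ ∀ x ∈ E, ¬ (p ≤ x ∧ x < e) := by
  have hfin : (insert a (E ∩ Set.Iio e)).Finite := (hE.subset Set.inter_subset_left).insert a
  obtain ⟨m, hm, hmax⟩ := hfin.exists_maximalFor id _ ⟨a, Set.mem_insert _ _⟩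
  have hme : m < e := by
    rcases hm with rfl | hm
    · exact hae
    · exact hm.2
  have hle : ∀ x ∈ insert a (E ∩ Set.Iio e), x ≤ m := by
    intro x hx
    rcases le_total x m with h | h
    · exact h
    · exact hmax hx h
  refine ⟨(m + e) / 2, ?_, by linarith, ?_⟩
  · linarith [hle a (Set.mem_insert _ _)]
  · rintro x hx ⟨h1, h2⟩
    linarith [hle x (Set.mem_insert_of_mem _ ⟨hx, h2⟩)]

/-- With `c` just before `e`, cutting the circle open at `c` makes `e` the first point of `E`. -/
theorem exists_forall_neg_inv_sub_lt {E : Set ℝ} (hE : E.Finite) (e : ℝ) :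
    ∃ c, c < e ∧ c ∉ E ∧ ∀ x ∈ E, x ≠ e → -(e - c)⁻¹ < -(x - c)⁻¹ := by
  obtain ⟨c, -, hc, h⟩ := exists_lt_forall_notMem hE (sub_one_lt e)
  refine ⟨c, hc, fun hcE => h c hcE ⟨le_rfl, hc⟩, fun x hx hxe => ?_⟩
  have h0 : 0 < e - c := by linarith
  rw [neg_lt_neg_iff]
  rcases lt_or_ge x c with hxc | hxc
  · have : (x - c)⁻¹ < 0 := inv_neg''.2 (by linarith)
    have : 0 < (e - c)⁻¹ := inv_pos.2 h0
    linarith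
  · have : e < x := lt_of_le_of_ne (not_lt.1 fun h' => h x hx ⟨hxc, h'⟩) hxe.symm
    exact inv_strictAnti₀ h0 (by linarith)

namespace SimpleGraph

variable {V : Type*} {G : SimpleGraph V} {S : Set V} {t h : V → ℝ} {β : V → V → ZMod 2}

theorem IsDrawing.map (D : G.IsDrawing S t h) {f : ℝ → ℝ} {E : Set ℝ} (ht : ∀ v ∈ S, t v ∈ E)
    (hh : ∀ v ∈ S, h v ∈ E) (hinj : Set.InjOn f E)
    (hf : ∀ a ∈ E, ∀ b ∈ E, ∀ c ∈ E, (LeftOf (f a) (f b) (f c) ↔ LeftOf a b c)) :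
    G.IsDrawing S (f ∘ t) (f ∘ h) where
  t_inj u hu w hw huw e := D.t_inj u hu w hw huw (hinj (ht u hu) (ht w hw) e)
  h_inj u hu w hw huw e := D.h_inj u hu w hw huw (hinj (hh u hu) (hh w hw) e)
  t_ne_h u hu w hw e := D.t_ne_h u hu w hw (hinj (ht u hu) (hh w hw) e)
  adj_iff u hu w hw huw := by
    simp only [Crosses, Function.comp, hf _ (ht u hu) _ (hh u hu) _ (hh w hw),
      hf _ (ht u hu) _ (hh u hu) _ (ht w hw)]
    exact D.adj_iff u hu w hw huw

theorem Realizes.map (D : G.Realizes β S t h) {f : ℝ → ℝ} {E : Set ℝ} (ht : ∀ v ∈ S, t v ∈ E)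
    (hh : ∀ v ∈ S, h v ∈ E) (hinj : Set.InjOn f E)
    (hf : ∀ a ∈ E, ∀ b ∈ E, ∀ c ∈ E, (LeftOf (f a) (f b) (f c) ↔ LeftOf a b c)) :
    G.Realizes β S (f ∘ t) (f ∘ h) where
  toIsDrawing := D.toIsDrawing.map ht hh hinj hf
  eq_one_iff u hu w hw huw := by
    rw [D.eq_one_iff u hu w hw huw]
    exact (hf _ (ht u hu) _ (hh u hu) _ (hh w hw)).symm

theorem injOn_neg_inv_sub (c : ℝ) : Set.InjOn (fun x => -(x - c)⁻¹) {x | x ≠ c} := by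
  intro a _ b _ hab
  simpa using hab

theorem IsDrawing.mono {T : Set V} (D : G.IsDrawing S t h) (hT : T ⊆ S) : G.IsDrawing T t h where
  t_inj u hu w hw := D.t_inj u (hT hu) w (hT hw)
  h_inj u hu w hw := D.h_inj u (hT hu) w (hT hw)
  t_ne_h u hu w hw := D.t_ne_h u (hT hu) w (hT hw)
  adj_iff u hu w hw := D.adj_iff u (hT hu) w (hT hw)

theorem IsDrawing.congr {t' h' : V → ℝ} (D : G.IsDrawing S t h) (ht : Set.EqOn t' t S)
    (hh : Set.EqOn h' h S) : G.IsDrawing S t' h' where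
  t_inj u hu w hw := by rw [ht hu, ht hw]; exact D.t_inj u hu w hw
  h_inj u hu w hw := by rw [hh hu, hh hw]; exact D.h_inj u hu w hw
  t_ne_h u hu w hw := by rw [ht hu, hh hw]; exact D.t_ne_h u hu w hw
  adj_iff u hu w hw := by rw [ht hu, hh hw, hh hu, ht hw]; exact D.adj_iff u hu w hw

/-- Once the tail of `y` comes first, the side of `y` on which another end lies is decided by
comparing it with `h y`. -/
theorem IsDrawing.exists_min [Finite V] (D : G.IsDrawing S t h) {y : V} (hy : y ∈ S) :
    ∃ t' h' : V → ℝ, G.IsDrawing S t' h' ∧ t' y < h' y ∧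
      ∀ x ∈ S, x ≠ y → t' y < t' x ∧ t' y < h' x := by
  have hE : (t '' S ∪ h '' S).Finite := (Set.toFinite _).union (Set.toFinite _)
  have ht : ∀ v ∈ S, t v ∈ t '' S ∪ h '' S := fun v hv => Or.inl ⟨v, hv, rfl⟩
  have hh : ∀ v ∈ S, h v ∈ t '' S ∪ h '' S := fun v hv => Or.inr ⟨v, hv, rfl⟩
  obtain ⟨c, -, hc, hmin⟩ := exists_forall_neg_inv_sub_lt hE (t y)
  have hne : ∀ x ∈ t '' S ∪ h '' S, x ≠ c := fun x hx e => hc (e ▸ hx)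
  refine ⟨_, _, D.map ht hh ((injOn_neg_inv_sub c).mono hne) ?_, ?_, ?_⟩
  · intro a ha b hb d hd
    exact leftOf_neg_inv_sub (hne a ha) (hne b hb) (hne d hd)
  · exact hmin _ (hh y hy) (D.t_ne_h y hy y hy).symm
  · intro x hx hxy
    exact ⟨hmin _ (ht x hx) (D.t_inj x hx y hy hxy), hmin _ (hh x hx) (D.t_ne_h y hy x hx).symm⟩

theorem IsDrawing.union (D₁ : G.IsDrawing S t h) (D₂ : G.IsDrawing Sᶜ t h)
    (hne : ∀ x ∈ S, ∀ y ∉ S, t x ≠ t y ∧ h x ≠ h y ∧ t x ≠ h y ∧ t y ≠ h x)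
    (hadj : ∀ x ∈ S, ∀ y ∉ S, (G.Adj x y ↔ Crosses (t x) (h x) (t y) (h y))) :
    G.IsDrawing Set.univ t h where
  t_inj u _ w _ huw := by
    by_cases hu : u ∈ S <;> by_cases hw : w ∈ S
    · exact D₁.t_inj u hu w hw huw
    · exact (hne u hu w hw).1
    · exact (hne w hw u hu).1.symm
    · exact D₂.t_inj u hu w hw huw
  h_inj u _ w _ huw := by
    by_cases hu : u ∈ S <;> by_cases hw : w ∈ S
    · exact D₁.h_inj u hu w hw huw
    · exact (hne u hu w hw).2.1
    · exact (hne w hw u hu).2.1.symm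
    · exact D₂.h_inj u hu w hw huw
  t_ne_h u _ w _ := by
    by_cases hu : u ∈ S <;> by_cases hw : w ∈ S
    · exact D₁.t_ne_h u hu w hw
    · exact (hne u hu w hw).2.2.1
    · exact (hne w hw u hu).2.2.2
    · exact D₂.t_ne_h u hu w hw
  adj_iff u _ w _ huw := by
    by_cases hu : u ∈ S <;> by_cases hw : w ∈ S
    · exact D₁.adj_iff u hu w hw huw
    · exact hadj u hu w hw
    · rw [G.adj_comm, hadj w hw u hu]
      apply crosses_comm
      obtain ⟨h1, h2, h3, h4⟩ := hne w hw u hu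
      have h5 := D₁.t_ne_h w hw w hw
      have h6 := D₂.t_ne_h u hu u hu
      simp [*, Ne.symm]
    · exact D₂.adj_iff u hu w hw huw

theorem IsDrawing.of_induce {t h : S → ℝ} (D : (G.induce S).IsDrawing Set.univ t h) :
    ∃ t' h' : V → ℝ, (∀ v : S, t' v = t v) ∧ (∀ v : S, h' v = h v) ∧ G.IsDrawing S t' h' := by
  classical
  refine ⟨fun v => if hv : v ∈ S then t ⟨v, hv⟩ else 0,
    fun v => if hv : v ∈ S then h ⟨v, hv⟩ else 0, by simp, by simp, ?_, ?_, ?_, ?_⟩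
  · intro u hu w hw huw
    simpa [hu, hw] using D.t_inj ⟨u, hu⟩ trivial ⟨w, hw⟩ trivial (by simpa using huw)
  · intro u hu w hw huw
    simpa [hu, hw] using D.h_inj ⟨u, hu⟩ trivial ⟨w, hw⟩ trivial (by simpa using huw)
  · intro u hu w hw
    simpa [hu, hw] using D.t_ne_h ⟨u, hu⟩ trivial ⟨w, hw⟩ trivial
  · intro u hu w hw huw
    simpa [hu, hw] using D.adj_iff ⟨u, hu⟩ trivial ⟨w, hw⟩ trivial (by simpa using huw)

theorem Realizes.of_induce {t h : S → ℝ}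
    (D : (G.induce S).Realizes (fun u w => β u w) Set.univ t h) :
    ∃ t' h' : V → ℝ, G.Realizes β S t' h' := by
  obtain ⟨t', h', e1, e2, D'⟩ := D.toIsDrawing.of_induce
  refine ⟨t', h', D', ?_⟩
  intro u hu w hw huw
  have := D.eq_one_iff ⟨u, hu⟩ trivial ⟨w, hw⟩ trivial (by simpa using huw)
  rwa [← e1, ← e2, ← e2] at this

theorem abs_arctan_lt_two (x : ℝ) : -2 < Real.arctan x ∧ Real.arctan x < 2 := by
  have := Real.arctan_lt_pi_div_two x
  have := Real.neg_pi_div_two_lt_arctan x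
  have := Real.pi_lt_four
  constructor <;> linarith

theorem exists_isDrawing_of_not_adj {X : Set V} {t₁ h₁ t₂ h₂ : V → ℝ}
    (hX : ∀ x ∈ X, ∀ y ∉ X, ¬ G.Adj x y) (D₁ : G.IsDrawing X t₁ h₁)
    (D₂ : G.IsDrawing Xᶜ t₂ h₂) : ∃ t h : V → ℝ, G.IsDrawing Set.univ t h := by
  classical
  -- `arctan` squeezes each drawing into an interval of length 4; the shift by 10 makes the two
  -- intervals disjoint.
  have m₂ : StrictMono fun x => Real.arctan x + 10 := Real.arctan_strictMono.add_const 10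
  have m₁ := Real.arctan_strictMono
  have D₁' := D₁.map (f := Real.arctan) (E := Set.univ) (by simp) (by simp)
    m₁.injective.injOn (fun a _ b _ c _ => leftOf_strictMono m₁ a b c)
  have D₂' := D₂.map (f := fun x => Real.arctan x + 10) (E := Set.univ) (by simp) (by simp)
    m₂.injective.injOn (fun a _ b _ c _ => leftOf_strictMono m₂ a b c)
  refine ⟨fun v => if v ∈ X then Real.arctan (t₁ v) else Real.arctan (t₂ v) + 10,
    fun v => if v ∈ X then Real.arctan (h₁ v) else Real.arctan (h₂ v) + 10,
    IsDrawing.union (S := X) (D₁'.congr ?_ ?_) (D₂'.congr ?_ ?_) ?_ ?_⟩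
  · intro v hv; simp [hv]
  · intro v hv; simp [hv]
  · intro v hv; simp [show v ∉ X from hv]
  · intro v hv; simp [show v ∉ X from hv]
  · intro x hx y hy
    have := abs_arctan_lt_two (t₁ x)
    have := abs_arctan_lt_two (h₁ x)
    have := abs_arctan_lt_two (t₂ y)
    have := abs_arctan_lt_two (h₂ y)
    simp only [hx, hy, if_true, if_false]
    refine ⟨?_, ?_, ?_, ?_⟩ <;> intro e <;> linarith
  · intro x hx y hy
    have := abs_arctan_lt_two (t₁ x)
    have := abs_arctan_lt_two (h₁ x)
    have := abs_arctan_lt_two (t₂ y)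
    have := abs_arctan_lt_two (h₂ y)
    simp only [hx, hy, if_true, if_false, hX x hx y hy, false_iff]
    unfold Crosses LeftOf
    grind

/-- The positions `x < c` and `x > c`, moved to disjoint intervals around `d` and `d + 20`. -/
noncomputable def cutAt (c d x : ℝ) : ℝ :=
  Real.arctan x + if x < c then d else d + 20

theorem cutAt_strictMono (c d : ℝ) : StrictMono (cutAt c d) := by
  intro x y hxy
  have := Real.arctan_strictMono hxy
  unfold cutAt
  split_ifs <;> linarith

theorem cutAt_bounds (c d x : ℝ) : (x < c → d - 2 < cutAt c d x ∧ cutAt c d x < d + 2) ∧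
    (¬ x < c → d + 18 < cutAt c d x ∧ cutAt c d x < d + 22) := by
  have := abs_arctan_lt_two x
  unfold cutAt
  constructor <;> intro h <;> simp only [h, if_true, if_false] <;> constructor <;> linarith

/-- Each marker chord cuts its drawing into two arcs. These are placed alternately: the arcs holding
`X` around 0 and 20, the others around 10 and 30. Chords of different sides cross exactly when both
run between their two arcs, that is, when both cross their marker. -/
theorem exists_isDrawing_of_split [Finite V] {X : Set V} {x₀ y₀ : V} {t₁ h₁ t₂ h₂ : V → ℝ}
    (hx₀ : x₀ ∈ X) (hy₀ : y₀ ∉ X) (hX : ∀ x ∈ X, ∀ y ∉ X, (G.Adj x y ↔ G.Adj x y₀ ∧ G.Adj x₀ y))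
    (D₁ : G.IsDrawing (insert y₀ X) t₁ h₁) (D₂ : G.IsDrawing (insert x₀ Xᶜ) t₂ h₂) :
    ∃ t h : V → ℝ, G.IsDrawing Set.univ t h := by
  classical
  obtain ⟨t₁, h₁, D₁, l₁, m₁⟩ := D₁.exists_min (Set.mem_insert _ _)
  obtain ⟨t₂, h₂, D₂, l₂, m₂⟩ := D₂.exists_min (Set.mem_insert _ _)
  have s₁ := cutAt_strictMono (h₁ y₀) 0
  have s₂ := cutAt_strictMono (h₂ x₀) 10
  have D₁' := (D₁.mono (Set.subset_insert _ _)).map (f := cutAt (h₁ y₀) 0) (E := Set.univ)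
    (by simp) (by simp) s₁.injective.injOn (fun a _ b _ c _ => leftOf_strictMono s₁ a b c)
  have D₂' := (D₂.mono (Set.subset_insert _ _)).map (f := cutAt (h₂ x₀) 10) (E := Set.univ)
    (by simp) (by simp) s₂.injective.injOn (fun a _ b _ c _ => leftOf_strictMono s₂ a b c)
  refine ⟨fun v => if v ∈ X then cutAt (h₁ y₀) 0 (t₁ v) else cutAt (h₂ x₀) 10 (t₂ v),
    fun v => if v ∈ X then cutAt (h₁ y₀) 0 (h₁ v) else cutAt (h₂ x₀) 10 (h₂ v),
    IsDrawing.union (S := X) (D₁'.congr ?_ ?_) (D₂'.congr ?_ ?_) ?_ ?_⟩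
  · intro v hv; simp [hv]
  · intro v hv; simp [hv]
  · intro v hv; simp [show v ∉ X from hv]
  · intro v hv; simp [show v ∉ X from hv]
  · intro x hx y hy
    have := cutAt_bounds (h₁ y₀) 0 (t₁ x)
    have := cutAt_bounds (h₁ y₀) 0 (h₁ x)
    have := cutAt_bounds (h₂ x₀) 10 (t₂ y)
    have := cutAt_bounds (h₂ x₀) 10 (h₂ y)
    simp only [hx, hy, if_true, if_false]
    refine ⟨?_, ?_, ?_, ?_⟩ <;> intro e <;> grind
  · intro x hx y hy
    have hxy₀ : x ≠ y₀ := by rintro rfl; exact hy₀ hx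
    have hyx₀ : y ≠ x₀ := by rintro rfl; exact hy hx₀
    have b1 := cutAt_bounds (h₁ y₀) 0 (t₁ x)
    have b2 := cutAt_bounds (h₁ y₀) 0 (h₁ x)
    have b3 := cutAt_bounds (h₂ x₀) 10 (t₂ y)
    have b4 := cutAt_bounds (h₂ x₀) 10 (h₂ y)
    have a1 := D₁.adj_iff y₀ (Set.mem_insert _ _) x (Set.mem_insert_of_mem _ hx) hxy₀.symm
    have a2 := D₂.adj_iff x₀ (Set.mem_insert _ _) y (Set.mem_insert_of_mem _ hy) hyx₀.symm
    obtain ⟨n1, n2⟩ := m₁ x (Set.mem_insert_of_mem _ hx) hxy₀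
    obtain ⟨n3, n4⟩ := m₂ y (Set.mem_insert_of_mem _ hy) hyx₀
    have e1 := D₁.t_ne_h x (Set.mem_insert_of_mem _ hx) y₀ (Set.mem_insert _ _)
    have e2 := D₁.h_inj x (Set.mem_insert_of_mem _ hx) y₀ (Set.mem_insert _ _) hxy₀
    have e3 := D₂.t_ne_h y (Set.mem_insert_of_mem _ hy) x₀ (Set.mem_insert _ _)
    have e4 := D₂.h_inj y (Set.mem_insert_of_mem _ hy) x₀ (Set.mem_insert _ _) hyx₀
    have side : ∀ {a b c : ℝ}, a < b → a < c → (LeftOf a b c ↔ ¬ c ≤ b) := by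
      intro a b c h1 h2; unfold LeftOf; grind
    unfold Crosses at a1 a2
    rw [side l₁ n1, side l₁ n2, le_iff_lt_or_eq, le_iff_lt_or_eq] at a1
    rw [side l₂ n3, side l₂ n4, le_iff_lt_or_eq, le_iff_lt_or_eq] at a2
    simp only [e1, e2, or_false] at a1
    simp only [e3, e4, or_false] at a2
    rw [hX x hx y hy, G.adj_comm x y₀, a1, a2]
    simp only [hx, hy, if_true, if_false]
    unfold Crosses LeftOf
    by_cases c1 : t₁ x < h₁ y₀ <;> by_cases c2 : h₁ x < h₁ y₀ <;>
    by_cases c3 : t₂ y < h₂ x₀ <;> by_cases c4 : h₂ y < h₂ x₀ <;>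
      simp only [c1, c2, c3, c4, true_imp_iff, not_true_eq_false, not_false_eq_true,
        false_imp_iff, true_and, and_true] at b1 b2 b3 b4 ⊢ <;> grind

end SimpleGraph

/-! ### Bad cliques and bad stars give cuts of rank at most one. -/

namespace SimpleGraph

variable {V : Type*} {G : SimpleGraph V} {β : V → V → ZMod 2}

/-- Four pairwise adjacent vertices on which `β` is not realized by any four chords. -/
structure IsBadClique (G : SimpleGraph V) (β : V → V → ZMod 2) (a b c d : V) : Prop where
  ab : G.Adj a b
  ac : G.Adj a c
  ad : G.Adj a d
  bc : G.Adj b c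
  bd : G.Adj b d
  cd : G.Adj c d
  ab_cd : β a c + β a d + β b c + β b d = 1
  ac_bd : β a b + β a d + β c b + β c d = 1
  ad_bc : β a b + β a c + β d b + β d c = 1

/-- A vertex `y` with three pairwise nonadjacent neighbours, each of which separates the other two
according to `β`. -/
structure IsBadStar (G : SimpleGraph V) (β : V → V → ZMod 2) (y p q r : V) : Prop where
  yp : G.Adj y p
  yq : G.Adj y q
  yr : G.Adj y r
  pq : ¬ G.Adj p q
  pr : ¬ G.Adj p r
  qr : ¬ G.Adj q r
  ne_pq : p ≠ q
  ne_pr : p ≠ r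
  ne_qr : q ≠ r
  sep_p : β p q + β p r = 1
  sep_q : β q p + β q r = 1
  sep_r : β r p + β r q = 1

/-- `z` agrees with `a` up to a constant, as seen from `b`, `c` and `d`. -/
structure IsLike (β : V → V → ZMod 2) (a b c d z : V) : Prop where
  ne_b : z ≠ b
  ne_c : z ≠ c
  ne_d : z ≠ d
  bc : β b z + β a b = β c z + β a c
  bd : β b z + β a b = β d z + β a d

variable {a b c d : V}

theorem IsBadClique.swap_ab (hβ : G.IsNajiSolution β) (h : G.IsBadClique β a b c d) :
    G.IsBadClique β b a c d := by
  obtain ⟨ab, ac, ad, bc, bd, cd, h1, h2, h3⟩ := h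
  have := hβ.ns1 a b ab
  have := hβ.ns1 a c ac
  have := hβ.ns1 a d ad
  have := hβ.ns1 b c bc
  have := hβ.ns1 b d bd
  have := hβ.ns1 c d cd
  refine ⟨ab.symm, bc, bd, ac, ad, cd, ?_, ?_, ?_⟩ <;> grind

theorem IsBadClique.swap_cd (h : G.IsBadClique β a b c d) :
    G.IsBadClique β a b d c := by
  obtain ⟨ab, ac, ad, bc, bd, cd, h1, h2, h3⟩ := h
  refine ⟨ab, ad, ac, bd, bc, cd.symm, ?_, ?_, ?_⟩ <;> grind

theorem IsBadClique.swap_ac_bd (hβ : G.IsNajiSolution β) (h : G.IsBadClique β a b c d) :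
    G.IsBadClique β c d a b := by
  obtain ⟨ab, ac, ad, bc, bd, cd, h1, h2, h3⟩ := h
  have := hβ.ns1 a b ab
  have := hβ.ns1 a c ac
  have := hβ.ns1 a d ad
  have := hβ.ns1 b c bc
  have := hβ.ns1 b d bd
  have := hβ.ns1 c d cd
  refine ⟨cd, ac.symm, bc.symm, ad.symm, bd.symm, ab, ?_, ?_, ?_⟩ <;> grind

theorem IsLike.swap_bc {z : V} (h : IsLike β a b c d z) : IsLike β a c b d z :=
  ⟨h.ne_c, h.ne_b, h.ne_d, h.bc.symm, h.bc.symm.trans h.bd⟩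

theorem IsLike.swap_cd {z : V} (h : IsLike β a b c d z) : IsLike β a b d c z :=
  ⟨h.ne_b, h.ne_d, h.ne_c, h.bd, h.bc⟩

/-- If `z` were adjacent to `b` but not `c`, eliminating the values of `β` at `z` would contradict
`ac_bd` when `z` is adjacent to `d`, and `ab_cd` otherwise. -/
theorem IsBadClique.adj_c_of_adj_b (hβ : G.IsNajiSolution β) (h : G.IsBadClique β a b c d) {z : V}
    (hz : IsLike β a b c d z) (hzb : G.Adj z b) : G.Adj z c := by
  by_contra hzc
  obtain ⟨ab, ac, ad, bc, bd, cd, h1, h2, h3⟩ := h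
  obtain ⟨nb, nc, nd, e1, e2⟩ := hz
  have i1 := hβ.ns1 a b ab
  have i2 := hβ.ns1 a c ac
  have i3 := hβ.ns1 a d ad
  have i4 := hβ.ns1 b c bc
  have i5 := hβ.ns1 b d bd
  have i6 := hβ.ns1 c d cd
  have n1 := hβ.ns3 b z c nb.symm bc.ne nc hzb.symm bc hzc
  by_cases hzd : G.Adj z d
  · have n2 := hβ.ns3 d z c nd.symm cd.ne' nc hzd.symm cd.symm hzc
    grind
  · have n2 := hβ.ns3 b z d nb.symm bd.ne nd hzb.symm bd hzd
    have n3 := hβ.ns2 z c d nc nd cd.ne cd hzc hzd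
    grind

theorem IsBadClique.adj_iff (hβ : G.IsNajiSolution β) (h : G.IsBadClique β a b c d) {z : V}
    (hz : IsLike β a b c d z) : (G.Adj z b ↔ G.Adj z c) ∧ (G.Adj z b ↔ G.Adj z d) := by
  have hacb : G.IsBadClique β a c b d :=
    ⟨h.ac, h.ab, h.ad, h.bc.symm, h.cd, h.bd, h.ac_bd, h.ab_cd, by
      have := h.ad_bc; grind⟩
  have hadb : G.IsBadClique β a d b c :=
    ⟨h.ad, h.ab, h.ac, h.bd.symm, h.cd.symm, h.bc, h.ad_bc, by
      have := h.ab_cd; grind, by have := h.ac_bd; grind⟩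
  exact ⟨⟨h.adj_c_of_adj_b hβ hz, hacb.adj_c_of_adj_b hβ hz.swap_bc⟩,
    ⟨(h.swap_cd).adj_c_of_adj_b hβ hz.swap_cd,
      hadb.adj_c_of_adj_b hβ hz.swap_cd.swap_bc⟩⟩

theorem IsBadClique.adj_iff_of_isLike (hβ : G.IsNajiSolution β) (h : G.IsBadClique β a b c d)
    {x y : V} (hx : IsLike β a b c d x) (hy : IsLike β c d a b y) (hxy : x ≠ y) :
    G.Adj x y ↔ G.Adj x c ∧ G.Adj y a := by
  obtain ⟨x1, x2⟩ := h.adj_iff hβ hx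
  obtain ⟨y1, y2⟩ := (h.swap_ac_bd hβ).adj_iff hβ hy
  obtain ⟨ab, ac, ad, bc, bd, cd, h1, h2, h3⟩ := h
  obtain ⟨nb, nc, nd, e1, e2⟩ := hx
  obtain ⟨mb, mc, md, f1, f2⟩ := hy
  have i1 := hβ.ns1 a b ab
  have i2 := hβ.ns1 a c ac
  have i3 := hβ.ns1 a d ad
  have i4 := hβ.ns1 b c bc
  have i5 := hβ.ns1 b d bd
  have i6 := hβ.ns1 c d cd
  have xb : G.Adj x b ↔ G.Adj x c := x1
  have xd : G.Adj x d ↔ G.Adj x c := x2.symm.trans x1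
  have yd : G.Adj y d ↔ G.Adj y a := y1
  have yb : G.Adj y b ↔ G.Adj y a := y2.symm.trans y1
  clear x1 x2 y1 y2
  by_cases hxc : G.Adj x c <;> by_cases hya : G.Adj y a <;>
    simp only [hxc, hya, and_true, and_false, and_self, iff_true, iff_false] at *
  · by_contra hn
    have n1 := hβ.ns3 b x y nb.symm md.symm hxy xb.symm yb.symm hn
    have n2 := hβ.ns3 d x y nd.symm mb.symm hxy xd.symm yd.symm hn
    grind
  · intro hn
    have n1 := hβ.ns3 x y b hxy nb md hn xb yb
    have n2 := hβ.ns3 x y d hxy nd mb hn xd yd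
    have n3 := hβ.ns2 y b d md mb bd.ne bd yb yd
    have n4 := hβ.ns1 x b xb
    have n5 := hβ.ns1 x d xd
    grind
  · intro hn
    have n1 := hβ.ns3 y x b hxy.symm md nb hn.symm yb xb
    have n2 := hβ.ns3 y x d hxy.symm mb nd hn.symm yd xd
    have n3 := hβ.ns2 x b d nb nd bd.ne bd xb xd
    have n4 := hβ.ns1 y b yb
    have n5 := hβ.ns1 y d yd
    grind
  · intro hn
    have n1 := hβ.ns2 b x y nb.symm md.symm hxy hn (fun h => xb h.symm) (fun h => yb h.symm)
    have n2 := hβ.ns2 d x y nd.symm mb.symm hxy hn (fun h => xd h.symm) (fun h => yd h.symm)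
    grind

/-- A count in F₂⁴. For `z` outside the clique, being like `a` allows 4 of the 16 vectors (β a z, β
b z, β c z, β d z): the last three entries are fixed up to a constant and the first is free. The
clique sums equal to 1 say that the four classes are disjoint, so they exhaust the 16 vectors. -/
theorem IsBadClique.isLike_or (hβ : G.IsNajiSolution β) (h : G.IsBadClique β a b c d) (z : V) :
    IsLike β a b c d z ∨ IsLike β b a c d z ∨ IsLike β c d a b z ∨ IsLike β d c a b z := by
  obtain ⟨ab, ac, ad, bc, bd, cd, h1, h2, h3⟩ := h
  have i1 := hβ.ns1 a b ab
  have i2 := hβ.ns1 a c ac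
  have i3 := hβ.ns1 a d ad
  have i4 := hβ.ns1 b c bc
  have i5 := hβ.ns1 b d bd
  have i6 := hβ.ns1 c d cd
  by_cases hza : z = a
  · subst hza
    exact Or.inl ⟨ab.ne, ac.ne, ad.ne, by grind, by grind⟩
  by_cases hzb : z = b
  · subst hzb
    exact Or.inr (Or.inl ⟨ab.ne', bc.ne, bd.ne, by grind, by grind⟩)
  by_cases hzc : z = c
  · subst hzc
    exact Or.inr (Or.inr (Or.inl ⟨cd.ne, ac.ne', bc.ne', by grind, by grind⟩))
  by_cases hzd : z = d
  · subst hzd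
    exact Or.inr (Or.inr (Or.inr ⟨cd.ne', ad.ne', bd.ne', by grind, by grind⟩))
  have bit : ∀ x : ZMod 2, x = 0 ∨ x = 1 := by decide
  by_contra hcon
  have c1 : ¬ (β b z + β a b = β c z + β a c ∧ β b z + β a b = β d z + β a d) :=
    fun h => hcon (Or.inl ⟨hzb, hzc, hzd, h.1, h.2⟩)
  have c2 : ¬ (β a z + β b a = β c z + β b c ∧ β a z + β b a = β d z + β b d) :=
    fun h => hcon (Or.inr (Or.inl ⟨hza, hzc, hzd, h.1, h.2⟩))
  have c3 : ¬ (β d z + β c d = β a z + β c a ∧ β d z + β c d = β b z + β c b) :=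
    fun h => hcon (Or.inr (Or.inr (Or.inl ⟨hzd, hza, hzb, h.1, h.2⟩)))
  have c4 : ¬ (β c z + β d c = β a z + β d a ∧ β c z + β d c = β b z + β d b) :=
    fun h => hcon (Or.inr (Or.inr (Or.inr ⟨hzc, hza, hzb, h.1, h.2⟩)))
  have e1 := bit (β a z)
  have e2 := bit (β b z)
  have e3 := bit (β c z)
  have e4 := bit (β d z)
  have e5 := bit (β a b)
  have e6 := bit (β a c)
  have e7 := bit (β a d)
  have e8 := bit (β b c)
  grind (splits := 30)

/-- `X` is one side of a cut across which the adjacency matrix has rank at most one. -/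
def IsRankOneCut (G : SimpleGraph V) (X : Set V) : Prop :=
  ∃ P Q : V → Prop, ∀ x ∈ X, ∀ y ∉ X, (G.Adj x y ↔ P x ∧ Q y)

theorem IsBadClique.exists_isRankOneCut (hβ : G.IsNajiSolution β) (h : G.IsBadClique β a b c d) :
    ∃ X : Set V, a ∈ X ∧ b ∈ X ∧ c ∉ X ∧ d ∉ X ∧ G.IsRankOneCut X := by
  have i1 := hβ.ns1 a b h.ab
  have i2 := hβ.ns1 a c h.ac
  have i3 := hβ.ns1 a d h.ad
  have i4 := hβ.ns1 b c h.bc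
  have i5 := hβ.ns1 b d h.bd
  -- One side consists of the vertices like `a` or `b`; those like `c` or `d` make up the other.
  refine ⟨{z | IsLike β a b c d z ∨ IsLike β b a c d z},
    Or.inl ⟨h.ab.ne, h.ac.ne, h.ad.ne, by grind, by grind⟩,
    Or.inr ⟨h.ab.ne', h.bc.ne, h.bd.ne, by grind, by grind⟩, ?_, ?_,
    fun x => G.Adj x c, fun y => G.Adj y a, ?_⟩
  · rintro (h | h)
    · exact h.ne_c rfl
    · exact h.ne_c rfl
  · rintro (h | h)
    · exact h.ne_d rfl
    · exact h.ne_d rfl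
  · intro x hx y hy
    have hxy : x ≠ y := by rintro rfl; exact hy hx
    have hy' : IsLike β c d a b y ∨ IsLike β d c a b y := by
      have := h.isLike_or hβ y
      simp only [Set.mem_ofPred_eq] at hy
      tauto
    rcases hx with hx | hx <;> rcases hy' with hy' | hy'
    · exact h.adj_iff_of_isLike hβ hx hy' hxy
    · rw [h.swap_cd.adj_iff_of_isLike hβ hx.swap_cd hy' hxy]
      have := h.adj_iff hβ hx
      tauto
    · rw [(h.swap_ab hβ).adj_iff_of_isLike hβ hx hy'.swap_cd hxy]
      have := (h.swap_ac_bd hβ).adj_iff hβ hy'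
      tauto
    · rw [(h.swap_ab hβ).swap_cd.adj_iff_of_isLike hβ hx.swap_cd hy'.swap_cd hxy]
      have := (h.swap_ab hβ).adj_iff hβ hx
      have := (h.swap_cd.swap_ac_bd hβ).adj_iff hβ hy'
      tauto

/-- Local complementation at `y`. -/
def localComplement (G : SimpleGraph V) (y : V) : SimpleGraph V where
  Adj u w := u ≠ w ∧ ¬ (G.Adj u w ↔ G.Adj u y ∧ G.Adj w y)
  symm := ⟨fun u w h => ⟨h.1.symm, by
    have := h.2
    rw [G.adj_comm w u]
    tauto⟩⟩
  loopless := ⟨fun _ h => h.1 rfl⟩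

theorem localComplement_adj_iff {y u w : V} :
    (G.localComplement y).Adj u w ↔ u ≠ w ∧ ¬ (G.Adj u w ↔ G.Adj u y ∧ G.Adj w y) :=
  Iff.rfl

open Classical in
/-- The solution of the Naji system of `G.localComplement y` obtained from `β`. -/
noncomputable def localComplementSolution (G : SimpleGraph V) (y : V) (β : V → V → ZMod 2)
    (x w : V) : ZMod 2 :=
  if x = y ∨ w = y ∧ G.Adj x y then β x w
  else β x w + 1 + β y (if G.Adj x y then w else x)

/-- The equations of the Naji system for three vertices. -/
theorem IsNajiSolution.triple (hβ : G.IsNajiSolution β) {x v w : V} (hxv : x ≠ v) (hxw : x ≠ w)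
    (hvw : v ≠ w) :
    (G.Adj x v → β x v + β v x = 1) ∧ (G.Adj x w → β x w + β w x = 1) ∧
    (G.Adj v w → β v w + β w v = 1) ∧
    (G.Adj v w → ¬ G.Adj x v → ¬ G.Adj x w → β x v + β x w = 0) ∧
    (G.Adj x w → ¬ G.Adj x v → ¬ G.Adj v w → β v x + β v w = 0) ∧
    (G.Adj x v → ¬ G.Adj x w → ¬ G.Adj v w → β w x + β w v = 0) ∧
    (¬ G.Adj v w → G.Adj x v → G.Adj x w → β v w + β w v + β x v + β x w = 1) ∧
    (¬ G.Adj x w → G.Adj x v → G.Adj v w → β x w + β w x + β v x + β v w = 1) ∧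
    (¬ G.Adj x v → G.Adj x w → G.Adj v w → β x v + β v x + β w x + β w v = 1) := by
  have s1 := G.adj_comm x v
  have s2 := G.adj_comm x w
  have s3 := G.adj_comm v w
  refine ⟨hβ.ns1 x v, hβ.ns1 x w, hβ.ns1 v w, hβ.ns2 x v w hxv hxw hvw, ?_, ?_, ?_, ?_, ?_⟩
  · intro h1 h2 h3
    exact hβ.ns2 v x w hxv.symm hvw hxw h1 (by tauto) h3
  · intro h1 h2 h3
    exact hβ.ns2 w x v hxw.symm hvw.symm hxv h1 (by tauto) (by tauto)
  · intro h1 h2 h3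
    exact hβ.ns3 x v w hxv hxw hvw h2 h3 h1
  · intro h1 h2 h3
    exact hβ.ns3 v x w hxv.symm hvw hxw h2.symm h3 h1
  · intro h1 h2 h3
    exact hβ.ns3 w x v hxw.symm hvw.symm hxv h2.symm h3.symm h1

/-- In a drawing, local complementation reverses the arc to the right of `y`. This changes the side
exactly for heads on that arc if the chord `x` crosses `y`, and for all heads if `x` lies wholly in
that arc; hence the added terms `1 + β y w` and `1 + β y x`. The equations are checked
algebraically, by cases on the adjacencies. -/
theorem IsNajiSolution.localComplement (hβ : G.IsNajiSolution β) (y : V) :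
    (G.localComplement y).IsNajiSolution (G.localComplementSolution y β) := by
  refine ⟨?_, ?_, ?_⟩
  · intro v w hvw
    have sy := fun u w => G.adj_comm u w
    have ir := fun u => G.irrefl (v := u)
    have n1 := hβ.ns1 v w
    have n2 := hβ.ns1 w y
    have n3 := hβ.ns1 v y
    have n4 := hβ.ns3 y v w
    have n5 := hβ.ns2 y v w
    simp only [localComplement_adj_iff, localComplementSolution] at *
    grind
  · intro x v w hxv hxw hvw h1 h2 h3
    simp only [localComplement_adj_iff, localComplementSolution, ne_eq, hxv, hxw, hvw,
      not_false_eq_true, true_and] at h1 h2 h3 ⊢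
    have s1 := G.adj_comm x v
    have s2 := G.adj_comm x w
    have s3 := G.adj_comm v w
    obtain ⟨p1, p2, p3, p4, p5, p6, p7, p8, p9⟩ := hβ.triple hxv hxw hvw
    by_cases hx : x = y
    · subst hx
      simp only [G.irrefl, G.adj_comm v x, G.adj_comm w x, hxv.symm, hxw.symm, true_or, if_true,
        false_and, iff_false, not_not] at h1 h2 h3 ⊢
      by_cases a1 : G.Adj x v <;> by_cases a2 : G.Adj x w <;> by_cases a3 : G.Adj v w <;> grind
    by_cases hv : v = y
    · subst hv
      simp only [G.irrefl, G.adj_comm w v, hxv, hvw.symm,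
        true_and, and_false, iff_false, not_not, false_or] at h1 h2 h3 ⊢
      by_cases a1 : G.Adj x v <;> by_cases a2 : G.Adj x w <;> by_cases a3 : G.Adj v w <;> grind
    by_cases hw : w = y
    · subst hw
      simp only [G.irrefl, hxw, hvw,
        true_and, and_false, iff_false, not_not, false_or] at h1 h2 h3 ⊢
      by_cases a1 : G.Adj x v <;> by_cases a2 : G.Adj x w <;> by_cases a3 : G.Adj v w <;> grind
    obtain ⟨-, q2, q3, q4, q5, q6, q7, q8, q9⟩ := hβ.triple hxv hx hv
    obtain ⟨-, -, r3, r4, r5, r6, r7, r8, r9⟩ := hβ.triple hxw hx hw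
    obtain ⟨-, -, -, u4, u5, u6, u7, u8, u9⟩ := hβ.triple hvw hv hw
    clear s1 s2 s3
    simp only [hx, hv, hw, false_or, false_and, if_false] at h1 h2 h3 ⊢
    by_cases ax : G.Adj x y <;> by_cases av : G.Adj v y <;> by_cases aw : G.Adj w y <;>
      by_cases a1 : G.Adj x v <;> by_cases a2 : G.Adj x w <;> by_cases a3 : G.Adj v w <;>
      simp only [ax, av, aw, a1, a2, a3, if_true, if_false, true_imp_iff, false_imp_iff,
        not_true_eq_false, not_false_eq_true, and_self, and_true, and_false, iff_self, iff_true,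
        iff_false] at * <;> grind
  · intro x v w hxv hxw hvw h1 h2 h3
    simp only [localComplement_adj_iff, localComplementSolution, ne_eq, hxv, hxw, hvw,
      not_false_eq_true, true_and] at h1 h2 h3 ⊢
    have s1 := G.adj_comm x v
    have s2 := G.adj_comm x w
    have s3 := G.adj_comm v w
    obtain ⟨p1, p2, p3, p4, p5, p6, p7, p8, p9⟩ := hβ.triple hxv hxw hvw
    by_cases hx : x = y
    · subst hx
      simp only [G.irrefl, G.adj_comm v x, G.adj_comm w x, hxv.symm, hxw.symm, true_or, if_true,
        false_and, iff_false, not_not, false_or] at h1 h2 h3 ⊢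
      by_cases a1 : G.Adj x v <;> by_cases a2 : G.Adj x w <;> by_cases a3 : G.Adj v w <;> grind
    by_cases hv : v = y
    · subst hv
      simp only [G.irrefl, G.adj_comm w v, hxv, hvw.symm, true_or, if_true,
        true_and, and_false, iff_false, not_not, false_or] at h1 h2 h3 ⊢
      by_cases a1 : G.Adj x v <;> by_cases a2 : G.Adj x w <;> by_cases a3 : G.Adj v w <;> grind
    by_cases hw : w = y
    · subst hw
      simp only [G.irrefl, hxw, hvw, true_or, if_true,
        true_and, and_false, iff_false, not_not, false_or] at h1 h2 h3 ⊢
      by_cases a1 : G.Adj x v <;> by_cases a2 : G.Adj x w <;> by_cases a3 : G.Adj v w <;> grind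
    obtain ⟨-, q2, q3, q4, q5, q6, q7, q8, q9⟩ := hβ.triple hxv hx hv
    obtain ⟨-, -, r3, r4, r5, r6, r7, r8, r9⟩ := hβ.triple hxw hx hw
    obtain ⟨-, -, -, u4, u5, u6, u7, u8, u9⟩ := hβ.triple hvw hv hw
    clear s1 s2 s3
    simp only [hx, hv, hw, false_or, false_and, if_false] at h1 h2 h3 ⊢
    by_cases ax : G.Adj x y <;> by_cases av : G.Adj v y <;> by_cases aw : G.Adj w y <;>
      by_cases a1 : G.Adj x v <;> by_cases a2 : G.Adj x w <;> by_cases a3 : G.Adj v w <;>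
      simp only [ax, av, aw, a1, a2, a3, if_true, if_false, true_imp_iff, false_imp_iff,
        not_true_eq_false, not_false_eq_true, and_self, and_true, and_false, iff_self, iff_true,
        iff_false] at * <;> grind

theorem IsBadStar.isBadClique_localComplement (hβ : G.IsNajiSolution β) {y p q r : V}
    (h : G.IsBadStar β y p q r) :
    (G.localComplement y).IsBadClique (G.localComplementSolution y β) y p q r := by
  obtain ⟨yp, yq, yr, pq, pr, qr, npq, npr, nqr, s1, s2, s3⟩ := h
  have n1 := yp.ne
  have n2 := yq.ne
  have n3 := yr.ne
  have n4 := hβ.ns3 y p q n1 n2 npq yp yq pq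
  have n5 := hβ.ns3 y p r n1 n3 npr yp yr pr
  have n6 := hβ.ns3 y q r n2 n3 nqr yq yr qr
  constructor <;> simp [localComplement_adj_iff, localComplementSolution, yp.symm, yq.symm, yr.symm,
    yp.ne, yq.ne, yr.ne, yp.ne', yq.ne', yr.ne', pq, pr, qr, npq, npr, nqr] <;> grind

/-- Local complementation at `y ∈ X` is a row operation on the matrix of the cut: the row of `y` is
added to the rows of its neighbours. So the columns' predicate `Q` survives and `P` changes by the
same operation. -/
theorem IsRankOneCut.of_localComplement {X : Set V} {y : V} (hy : y ∈ X)
    (h : (G.localComplement y).IsRankOneCut X) : G.IsRankOneCut X := by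
  obtain ⟨P, Q, h⟩ := h
  refine ⟨fun x => ¬ (P x ↔ G.Adj x y ∧ P y), Q, fun x hx w hw => ?_⟩
  have h1 := h x hx w hw
  have h2 := h y hy w hw
  have hyw : y ≠ w := by rintro rfl; exact hw hy
  have hxw : x ≠ w := by rintro rfl; exact hw hx
  simp only [localComplement_adj_iff, ne_eq, hyw, hxw, not_false_eq_true, true_and, G.irrefl,
    false_and, iff_false, not_not, G.adj_comm y w] at h1 h2
  grind

theorem IsBadStar.exists_isRankOneCut (hβ : G.IsNajiSolution β) {y p q r : V}
    (h : G.IsBadStar β y p q r) :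
    ∃ X : Set V, y ∈ X ∧ p ∈ X ∧ q ∉ X ∧ r ∉ X ∧ G.IsRankOneCut X := by
  obtain ⟨X, h1, h2, h3, h4, hX⟩ :=
    (h.isBadClique_localComplement hβ).exists_isRankOneCut (hβ.localComplement y)
  exact ⟨X, h1, h2, h3, h4, hX.of_localComplement h1⟩

theorem IsRankOneCut.exists_markers {X : Set V} {a c : V} (ha : a ∈ X) (hc : c ∉ X)
    (h : G.IsRankOneCut X) : ∃ x₀ ∈ X, ∃ y₀ ∉ X,
      ∀ x ∈ X, ∀ y ∉ X, (G.Adj x y ↔ G.Adj x y₀ ∧ G.Adj x₀ y) := by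
  obtain ⟨P, Q, h⟩ := h
  -- The ends of any edge across the cut serve as markers; without such an edge any two vertices do.
  by_cases hPQ : ∃ x₀ ∈ X, ∃ y₀ ∉ X, P x₀ ∧ Q y₀
  · obtain ⟨x₀, hx₀, y₀, hy₀, hP, hQ⟩ := hPQ
    refine ⟨x₀, hx₀, y₀, hy₀, fun x hx y hy => ?_⟩
    rw [h x hx y hy, h x hx y₀ hy₀, h x₀ hx₀ y hy]
    tauto
  · refine ⟨a, ha, c, hc, fun x hx y hy => ?_⟩
    rw [h x hx y hy, h x hx c hc]
    constructor
    · rintro ⟨h1, h2⟩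
      exact absurd ⟨x, hx, y, hy, h1, h2⟩ hPQ
    · rintro ⟨⟨h1, h2⟩, -⟩
      exact absurd ⟨x, hx, c, hc, h1, h2⟩ hPQ

end SimpleGraph

/-! ### Finding a point to the left of all chords. -/

theorem ZMod.eq_zero_or_one (x : ZMod 2) : x = 0 ∨ x = 1 := by
  revert x; decide

theorem LeftOf.of_forall_notMem {t h p e : ℝ} (hl : LeftOf t h e) (hpe : p < e)
    (ht : ¬ (p ≤ t ∧ t < e)) (hh : ¬ (p ≤ h ∧ h < e)) : LeftOf t h p := by
  unfold LeftOf at *; grind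

/-- Three chords whose heads lie to the left of each other cyclically, but not in the reverse
direction, cross pairwise. -/
theorem crosses_of_leftOf_cycle {a b c d e f : ℝ} (hn : [a, b, c, d, e, f].Nodup)
    (h1 : LeftOf a b d) (h2 : ¬ LeftOf c d b) (h3 : LeftOf c d f) (h4 : ¬ LeftOf a b f) :
    Crosses a b c d := by
  simp only [List.nodup_cons, List.mem_cons, not_or, List.not_mem_nil,
    not_false_eq_true, and_true, List.nodup_nil] at hn
  have := crosses_comm (a := a) (b := b) (c := c) (d := d) (by simp; grind)
  by_contra hx
  have hx' := this.not.1 hx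
  unfold Crosses LeftOf at *
  grind (splits := 40)

namespace SimpleGraph

variable {V : Type*} {G : SimpleGraph V} {β : V → V → ZMod 2} {v : V} {t h : V → ℝ}

/-- This makes `β` a tournament on the neighbours of `v`, whether or not they are adjacent to each
other. -/
theorem IsNajiSolution.add_eq_one_of_adj (hβ : G.IsNajiSolution β) (hv : ∀ w, w ≠ v → β w v = 1)
    {y y' : V} (hy : G.Adj v y) (hy' : G.Adj v y') (hne : y ≠ y') : β y y' + β y' y = 1 := by
  by_cases hadj : G.Adj y y'
  · exact hβ.ns1 y y' hadj
  · have h1 := hβ.ns3 v y y' hy.ne hy'.ne hne hy hy' hadj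
    have h2 := hβ.ns1 v y hy
    have h3 := hβ.ns1 v y' hy'
    have h4 := hv y hy.ne'
    have h5 := hv y' hy'.ne'
    grind

/-- The chord `w` is to miss `v` and have `v` on its left, so the end of `y` on the far side of `v`
from `w` must be left of `w`. Which end that is depends on the side of `v` containing `w`, hence on
`β v w`. -/
theorem Realizes.leftOf_end (hβ : G.IsNajiSolution β) (hv : ∀ w, w ≠ v → β w v = 1)
    (D : G.Realizes β {v}ᶜ t h) {y w : V} (hy : G.Adj v y) (hwv : w ≠ v) (hw : ¬ G.Adj v w) :
    (β v w = 1 → LeftOf (t w) (h w) (h y)) ∧ (β v w = 0 → LeftOf (t w) (h w) (t y)) := by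
  have hwy : w ≠ y := by rintro rfl; exact hw hy
  have h1 := D.eq_one_iff w hwv y hy.ne' hwy
  have h2 := D.adj_iff w hwv y hy.ne' hwy
  have h3 := hv w hwv
  have h4 := hv y hy.ne'
  unfold Crosses at h2
  by_cases hadj : G.Adj w y
  · have h5 := hβ.ns3 y v w hy.ne' hwy.symm hwv.symm hy.symm hadj.symm hw
    have h6 := hβ.ns1 w y hadj
    constructor
    · intro h7
      exact h1.1 (by grind)
    · intro h7
      have : β w y ≠ 1 := by grind
      grind
  · have h5 := hβ.ns2 w v y hwv hwy hy.ne hy (fun h => hw h.symm) hadj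
    have : β w y = 1 := by grind
    grind

/-- A cyclic triple of neighbours would cross pairwise, by `crosses_of_leftOf_cycle`, and form a bad
clique together with `v`. -/
theorem Realizes.trans_of_forall_not_isBadClique (hβ : G.IsNajiSolution β)
    (hK : ∀ a b c d, ¬ G.IsBadClique β a b c d) (hv : ∀ w, w ≠ v → β w v = 1)
    (D : G.Realizes β {v}ᶜ t h) {x y z : V} (hx : G.Adj v x) (hy : G.Adj v y) (hz : G.Adj v z)
    (hxy : x ≠ y) (hyz : y ≠ z) (hxz : x ≠ z) (h1 : β x y = 1) (h2 : β y z = 1) : β x z = 1 := by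
  by_contra h3
  have e1 := hβ.add_eq_one_of_adj hv hx hy hxy
  have e2 := hβ.add_eq_one_of_adj hv hy hz hyz
  have e3 := hβ.add_eq_one_of_adj hv hx hz hxz
  have h3' : β x z = 0 := (ZMod.eq_zero_or_one _).resolve_right h3
  have h4 : β y x = 0 := by grind
  have h5 : β z y = 0 := by grind
  have h6 : β z x = 1 := by grind
  have key : ∀ {x y z : V}, G.Adj v x → G.Adj v y → G.Adj v z → x ≠ y → y ≠ z → x ≠ z →
      β x y = 1 → β y x = 0 → β y z = 1 → β x z = 0 → G.Adj x y := by
    intro x y z hx hy hz hxy hyz hxz h1 h2 h3 h4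
    have k1 := D.eq_one_iff x hx.ne' y hy.ne' hxy
    have k2 := D.eq_one_iff y hy.ne' x hx.ne' hxy.symm
    have k3 := D.eq_one_iff y hy.ne' z hz.ne' hyz
    have k4 := D.eq_one_iff x hx.ne' z hz.ne' hxz
    rw [D.adj_iff x hx.ne' y hy.ne' hxy]
    refine crosses_of_leftOf_cycle (D.nodup_three (w := z) hx.ne' hy.ne' hz.ne' hxy hxz hyz)
      (k1.1 h1) (fun h => ?_) (k3.1 h3) (fun h => ?_)
    · rw [← k2, h2] at h; simp at h
    · rw [← k4, h4] at h; simp at h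
  have a1 := key hx hy hz hxy hyz hxz h1 h4 h2 h3'
  have a2 := key hy hz hx hyz hxz.symm hxy.symm h2 h5 h6 h4
  have a3 := key hz hx hy hxz.symm hxy hyz.symm h6 h3' h1 h5
  have b1 := hv x hx.ne'
  have b2 := hv y hy.ne'
  have b3 := hv z hz.ne'
  have b4 := hβ.ns1 v x hx
  have b5 := hβ.ns1 v y hy
  have b6 := hβ.ns1 v z hz
  refine hK v x y z ⟨hx, hy, hz, a1, a3.symm, a2, ?_, ?_, ?_⟩ <;> grind

theorem Realizes.exists_top [Finite V] (hβ : G.IsNajiSolution β)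
    (hK : ∀ a b c d, ¬ G.IsBadClique β a b c d) (hv : ∀ w, w ≠ v → β w v = 1)
    (D : G.Realizes β {v}ᶜ t h) (hN : ∃ y, G.Adj v y) :
    ∃ y₀, G.Adj v y₀ ∧ ∀ y, G.Adj v y → y ≠ y₀ → β y y₀ = 1 := by
  let r : V → V → Prop := fun x y => G.Adj v x ∧ G.Adj v y ∧ x ≠ y ∧ β x y = 1
  have htrans : IsTrans V r := ⟨by
    rintro x y z ⟨hx, hy, hxy, h1⟩ ⟨-, hz, hyz, h2⟩
    have hxz : x ≠ z := by
      rintro rfl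
      have := hβ.add_eq_one_of_adj hv hx hy hxy
      rw [h1, h2] at this
      exact absurd this (by decide)
    exact ⟨hx, hz, hxz, D.trans_of_forall_not_isBadClique hβ hK hv hx hy hz hxy hyz hxz h1 h2⟩⟩
  have hirr : Std.Irrefl (Function.swap r) := ⟨fun x hx => hx.2.2.1 rfl⟩
  have htrans' : IsTrans V (Function.swap r) := ⟨fun x y z h1 h2 => htrans.trans _ _ _ h2 h1⟩
  obtain ⟨y₀, hy₀, hmin⟩ := (Finite.wellFounded_of_trans_of_irrefl (Function.swap r)).has_min
    {y | G.Adj v y} hN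
  refine ⟨y₀, hy₀, fun y hy hne => ?_⟩
  have h1 := hmin y hy
  have h2 : β y₀ y ≠ 1 := fun h => h1 ⟨hy₀, hy, hne.symm, h⟩
  have h3 := hβ.add_eq_one_of_adj hv hy hy₀ hne
  have h4 := (ZMod.eq_zero_or_one _).resolve_right h2
  rwa [h4, add_zero] at h3

theorem Realizes.exists_leftOf_of_min [Finite V] (hβ : G.IsNajiSolution β)
    (hS : ∀ a b c d, ¬ G.IsBadStar β a b c d) (hv : ∀ w, w ≠ v → β w v = 1)
    (D : G.Realizes β {v}ᶜ t h) {y₀ : V} (hy₀ : G.Adj v y₀)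
    (htop : ∀ y, G.Adj v y → y ≠ y₀ → β y y₀ = 1) (hmin₀ : h y₀ < t y₀)
    (hmin : ∀ w, w ≠ v → w ≠ y₀ → h y₀ < t w ∧ h y₀ < h w) {F : Set ℝ} (hF : F.Finite) :
    ∃ p ∉ F, ∀ w, w ≠ v → LeftOf (t w) (h w) p := by
  let E : Set ℝ := t '' {v}ᶜ ∪ h '' {v}ᶜ ∪ F
  have hE : E.Finite := ((Set.toFinite _).union (Set.toFinite _)).union hF
  have htE : ∀ w, w ≠ v → t w ∈ E := fun w hw => Or.inl (Or.inl ⟨w, hw, rfl⟩)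
  have hhE : ∀ w, w ≠ v → h w ∈ E := fun w hw => Or.inl (Or.inr ⟨w, hw, rfl⟩)
  -- The chords that force the new point away from the head of `y₀`: their left sides contain all
  -- tails of neighbours of `v`, but perhaps not that head.
  let T : Set V := {w | w ≠ v ∧ ¬ G.Adj v w ∧ β v w = 0}
  have hT : ∀ w ∈ T, ∀ y, G.Adj v y → LeftOf (t w) (h w) (t y) := fun w hw y hy =>
    (D.leftOf_end hβ hv hy hw.1 hw.2.1).2 hw.2.2
  let P : Set ℝ := {p | h y₀ < p ∧ p < t y₀ ∧ p ∉ E ∧ ∀ w ∈ T, LeftOf (t w) (h w) p}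
  have near : ∀ e, h y₀ < e → e ≤ t y₀ → (∀ w ∈ T, LeftOf (t w) (h w) e) → ∃ p ∈ P, p < e := by
    intro e h1 h2 h3
    obtain ⟨p, hp1, hp2, hp3⟩ := exists_lt_forall_notMem hE h1
    refine ⟨p, ⟨hp1, hp2.trans_le h2, fun h => hp3 p h ⟨le_rfl, hp2⟩, fun w hw => ?_⟩, hp2⟩
    exact (h3 w hw).of_forall_notMem hp2 (hp3 _ (htE w hw.1)) (hp3 _ (hhE w hw.1))
  have hP : P.Nonempty := by
    obtain ⟨p, hp, -⟩ := near (t y₀) hmin₀ le_rfl (fun w hw => hT w hw y₀ hy₀)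
    exact ⟨p, hp⟩
  -- Take the point as close after the head of `y₀` as the chords of `T` permit, measured by the
  -- number of ends in between. Then every end passed over fails to be left of some chord of `T`.
  obtain ⟨p, ⟨hp1, hp2, hpE, hpT⟩, hpmin⟩ :=
    (measure fun p => (E ∩ Set.Ioo (h y₀) p).ncard).wf.has_min P hP
  have first : ∀ e ∈ E, h y₀ < e → e < p → ∃ w ∈ T, ¬ LeftOf (t w) (h w) e := by
    intro e he h1 h2
    by_contra hcon
    push Not at hcon
    obtain ⟨q, hq, hqe⟩ := near e h1 (h2.trans hp2).le hcon
    refine hpmin q hq (Set.ncard_lt_ncard ⟨?_, fun hsub => ?_⟩ (hE.subset Set.inter_subset_left))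
    · exact Set.inter_subset_inter_right _ (Set.Ioo_subset_Ioo_right (hqe.trans h2).le)
    · exact (hsub ⟨he, h1, h2⟩).2.2.not_gt hqe
  have hpF : p ∉ F := fun h => hpE (Or.inr h)
  have hne : ∀ w, w ≠ v → p ≠ t w ∧ p ≠ h w := fun w hw =>
    ⟨fun e => hpE (e ▸ htE w hw), fun e => hpE (e ▸ hhE w hw)⟩
  refine ⟨p, hpF, fun w hw => ?_⟩
  by_cases hwy₀ : w = y₀
  · subst hwy₀
    exact Or.inr ⟨hmin₀, hp1, hp2⟩
  obtain ⟨m1, m2⟩ := hmin w hw hwy₀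
  obtain ⟨k1, k2⟩ := hne w hw
  by_cases hvw : G.Adj v w
  · have h1 := (D.eq_one_iff w hw y₀ hy₀.ne' hwy₀).1 (htop w hvw hwy₀)
    -- A tail of a neighbour of `v` is left of all of `T`, so it cannot have been passed over.
    have h3 : p < t w := by
      by_contra hcon
      obtain ⟨u, hu, hu'⟩ := first _ (htE w hw) m1 (lt_of_le_of_ne (not_lt.1 hcon) k1.symm)
      exact hu' (hT u hu w hvw)
    unfold LeftOf at h1 ⊢
    grind
  rcases ZMod.eq_zero_or_one (β v w) with h0 | h0
  · exact hpT w ⟨hw, hvw, h0⟩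
  by_contra hcon
  have h1 := (D.leftOf_end hβ hv hy₀ hw hvw).1 h0
  have h2 : t w < p ∧ p < h w := by
    unfold LeftOf at h1 hcon
    grind
  -- If `w` separates `p` from the head of `y₀`, its passed-over tail is blocked by some `u` in `T`.
  -- Then `y₀` crosses the pairwise noncrossing `v`, `u`, `w`, which make a bad star.
  obtain ⟨u, hu, hu'⟩ := first _ (htE w hw) m1 h2.1
  have h3 := hT u hu y₀ hy₀
  have h4 := hpT u hu
  have huw : u ≠ w := by
    rintro rfl
    rw [hu.2.2] at h0
    exact absurd h0 (by decide)
  have huy₀ : u ≠ y₀ := by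
    rintro rfl
    exact hu.2.1 hy₀
  have nadj : ¬ G.Adj u w := by
    intro hadj
    have := hβ.ns2 v u w hu.1.symm hw.symm huw hadj hu.2.1 hvw
    rw [hu.2.2, h0] at this
    exact absurd this (by decide)
  have hcr := (D.adj_iff u hu.1 w hw huw).not.1 nadj
  obtain ⟨n1, n2⟩ := hmin u hu.1 huy₀
  have hnd := D.nodup_two hu.1 hw huw
  simp only [List.nodup_cons, List.mem_cons, not_or, List.not_mem_nil,
    not_false_eq_true, and_true, List.nodup_nil] at hnd
  have l1 : ¬ LeftOf (t u) (h u) (h w) := by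
    unfold Crosses at hcr
    tauto
  have l2 : t w < h u ∧ h u < t u ∧ t u < h w := by
    unfold LeftOf at l1 hu' h4
    grind
  have l3 : h u < t y₀ ∧ t y₀ < t u := by
    unfold LeftOf at h3
    grind
  have l4 : ¬ LeftOf (t w) (h w) (h u) := by
    unfold LeftOf
    grind
  have l5 : ¬ LeftOf (t w) (h w) (t y₀) := by
    unfold LeftOf
    grind
  have l6 : ¬ LeftOf (t u) (h u) (h y₀) := by
    unfold LeftOf
    grind
  have a1 : G.Adj y₀ u := by
    rw [G.adj_comm, D.adj_iff u hu.1 y₀ hy₀.ne' huy₀]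
    unfold Crosses
    tauto
  have a2 : G.Adj y₀ w := by
    rw [G.adj_comm, D.adj_iff w hw y₀ hy₀.ne' hwy₀]
    unfold Crosses
    tauto
  have b1 : β u w = 0 := (ZMod.eq_zero_or_one _).resolve_right
    fun h => l1 ((D.eq_one_iff u hu.1 w hw huw).1 h)
  have b2 : β w u = 0 := (ZMod.eq_zero_or_one _).resolve_right
    fun h => l4 ((D.eq_one_iff w hw u hu.1 huw.symm).1 h)
  refine hS y₀ v u w ⟨hy₀.symm, a1, a2, hu.2.1, hvw, nadj, hu.1.symm, hw.symm, huw, ?_, ?_, ?_⟩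
  · rw [hu.2.2, h0, zero_add]
  · rw [hv u hu.1, b1, add_zero]
  · rw [hv w hw, b2, add_zero]

theorem Realizes.exists_leftOf [Finite V] (hβ : G.IsNajiSolution β)
    (hK : ∀ a b c d, ¬ G.IsBadClique β a b c d)
    (hS : ∀ a b c d, ¬ G.IsBadStar β a b c d) (hv : ∀ w, w ≠ v → β w v = 1)
    (D : G.Realizes β {v}ᶜ t h) (hN : ∃ y, G.Adj v y) {F : Set ℝ} (hF : F.Finite) :
    ∃ p ∉ F, ∀ w, w ≠ v → LeftOf (t w) (h w) p := by
  obtain ⟨y₀, hy₀, htop⟩ := D.exists_top hβ hK hv hN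
  let E : Set ℝ := t '' {v}ᶜ ∪ h '' {v}ᶜ
  have hE : E.Finite := (Set.toFinite _).union (Set.toFinite _)
  have htE : ∀ w ∈ ({v}ᶜ : Set V), t w ∈ E := fun w hw => Or.inl ⟨w, hw, rfl⟩
  have hhE : ∀ w ∈ ({v}ᶜ : Set V), h w ∈ E := fun w hw => Or.inr ⟨w, hw, rfl⟩
  obtain ⟨c, -, hc, hmin⟩ := exists_forall_neg_inv_sub_lt hE (h y₀)
  have hne : ∀ x ∈ E, x ≠ c := fun x hx e => hc (e ▸ hx)
  have D' := D.map htE hhE ((injOn_neg_inv_sub c).mono hne) fun a ha b hb d hd =>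
    leftOf_neg_inv_sub (hne a ha) (hne b hb) (hne d hd)
  obtain ⟨q, hq, hleft⟩ := D'.exists_leftOf_of_min hβ hS hv hy₀ htop
    (hmin _ (htE y₀ hy₀.ne') (D.t_ne_h y₀ hy₀.ne' y₀ hy₀.ne'))
    (fun w hw hwy => ⟨hmin _ (htE w hw) (D.t_ne_h w hw y₀ hy₀.ne'),
      hmin _ (hhE w hw) (D.h_inj w hw y₀ hy₀.ne' hwy)⟩)
    -- The value 0 is also avoided, since it corresponds to the point at infinity in the original
    -- coordinate.
    ((hF.image fun x => -(x - c)⁻¹).insert 0)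
  have hq0 : q ≠ 0 := fun e => hq (Or.inl e)
  have hqc : -(c - q⁻¹ - c)⁻¹ = q := by
    rw [sub_sub_cancel_left, inv_neg, inv_inv, neg_neg]
  refine ⟨c - q⁻¹, fun hF => hq (Or.inr ⟨_, hF, hqc⟩), fun w hw => ?_⟩
  have := hleft w hw
  rw [← hqc] at this
  refine (leftOf_neg_inv_sub (hne _ (htE w hw)) (hne _ (hhE w hw)) ?_).1 this
  simp [hq0]

end SimpleGraph

/-! ### Inserting a vertex, and the two inductions. -/

namespace SimpleGraph

variable {V : Type*} {G : SimpleGraph V} {β : V → V → ZMod 2} {v : V} {t h : V → ℝ}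

theorem IsBadClique.of_switch [DecidableRel G.Adj] {ρ : V → ZMod 2} {a b c d : V}
    (hb : G.IsBadClique (G.switch ρ β) a b c d) : G.IsBadClique β a b c d := by
  obtain ⟨ab, ac, ad, bc, bd, cd, h1, h2, h3⟩ := hb
  simp only [switch, ab, ac, ad, bc, bd, cd, cd.symm, bc.symm, bd.symm, if_true] at h1 h2 h3
  refine ⟨ab, ac, ad, bc, bd, cd, ?_, ?_, ?_⟩ <;> grind

theorem IsBadStar.of_switch [DecidableRel G.Adj] {ρ : V → ZMod 2} {y p q r : V}
    (hb : G.IsBadStar (G.switch ρ β) y p q r) : G.IsBadStar β y p q r := by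
  obtain ⟨yp, yq, yr, pq, pr, qr, npq, npr, nqr, s1, s2, s3⟩ := hb
  have qp : ¬ G.Adj q p := fun h => pq h.symm
  have rp : ¬ G.Adj r p := fun h => pr h.symm
  have rq : ¬ G.Adj r q := fun h => qr h.symm
  simp only [switch, pq, pr, qr, qp, rp, rq, if_false] at s1 s2 s3
  refine ⟨yp, yq, yr, pq, pr, qr, npq, npr, nqr, ?_, ?_, ?_⟩ <;> grind

theorem switch_switch [DecidableRel G.Adj] (ρ : V → ZMod 2) :
    G.switch ρ (G.switch ρ β) = β := by
  funext u w
  simp only [switch]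
  split_ifs <;> grind

theorem IsNajiSolution.induce (hβ : G.IsNajiSolution β) (S : Set V) :
    (G.induce S).IsNajiSolution fun u w => β u w where
  ns1 v w := hβ.ns1 v w
  ns2 x v w hxv hxw hvw := hβ.ns2 x v w (Subtype.coe_ne_coe.2 hxv) (Subtype.coe_ne_coe.2 hxw)
    (Subtype.coe_ne_coe.2 hvw)
  ns3 x v w hxv hxw hvw := hβ.ns3 x v w (Subtype.coe_ne_coe.2 hxv) (Subtype.coe_ne_coe.2 hxw)
    (Subtype.coe_ne_coe.2 hvw)

theorem IsBadClique.of_induce {S : Set V} {a b c d : S}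
    (hb : (G.induce S).IsBadClique (fun u w => β u w) a b c d) : G.IsBadClique β a b c d :=
  ⟨hb.ab, hb.ac, hb.ad, hb.bc, hb.bd, hb.cd, hb.ab_cd, hb.ac_bd, hb.ad_bc⟩

theorem IsBadStar.of_induce {S : Set V} {y p q r : S}
    (hb : (G.induce S).IsBadStar (fun u w => β u w) y p q r) : G.IsBadStar β y p q r :=
  ⟨hb.yp, hb.yq, hb.yr, hb.pq, hb.pr, hb.qr, Subtype.coe_ne_coe.2 hb.ne_pq,
    Subtype.coe_ne_coe.2 hb.ne_pr, Subtype.coe_ne_coe.2 hb.ne_qr, hb.sep_p, hb.sep_q, hb.sep_r⟩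

theorem Realizes.of_subsingleton [Subsingleton V] :
    G.Realizes β Set.univ (fun _ => 0) (fun _ => 1) where
  t_inj u _ w _ huw := absurd (Subsingleton.elim u w) huw
  h_inj u _ w _ huw := absurd (Subsingleton.elim u w) huw
  t_ne_h _ _ _ _ := zero_ne_one
  adj_iff u _ w _ huw := absurd (Subsingleton.elim u w) huw
  eq_one_iff u _ w _ huw := absurd (Subsingleton.elim u w) huw

/-- The new drawing has its own solution `β'`, which agrees with `β` away from `v` and on pairs
ending in `v`. On the pairs starting at `v`, `ns1` gives agreement at neighbours, and `ns2` and
`ns3` carry it along paths from `v`. -/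
theorem Realizes.insert [DecidableEq V] (hG : G.Connected) (hβ : G.IsNajiSolution β)
    (hv : ∀ w, w ≠ v → β w v = 1) (D : G.Realizes β {v}ᶜ t h) {p q : ℝ} (hpq : p ≠ q)
    (hp : ∀ w, w ≠ v → p ≠ t w ∧ p ≠ h w) (hq : ∀ w, w ≠ v → q ≠ t w ∧ q ≠ h w)
    (hp' : ∀ w, w ≠ v → LeftOf (t w) (h w) p)
    (hq' : ∀ w, w ≠ v → (LeftOf (t w) (h w) q ↔ ¬ G.Adj v w)) :
    G.Realizes β Set.univ (Function.update t v q) (Function.update h v p) := by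
  have ht : Set.EqOn (Function.update t v q) t {v}ᶜ := fun w hw => Function.update_of_ne hw _ _
  have hh : Set.EqOn (Function.update h v p) h {v}ᶜ := fun w hw => Function.update_of_ne hw _ _
  have D' : G.IsDrawing Set.univ (Function.update t v q) (Function.update h v p) := by
    refine (D.toIsDrawing.congr ht hh).union ?_ ?_ ?_
    · rw [compl_compl]
      refine ⟨?_, ?_, ?_, ?_⟩
      · rintro u rfl w rfl h
        exact absurd rfl h
      · rintro u rfl w rfl h
        exact absurd rfl h
      · rintro u rfl w rfl
        simpa using hpq.symm
      · rintro u rfl w rfl h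
        exact absurd rfl h
    · intro x hx y hy
      obtain rfl : y = v := by simpa using hy
      rw [ht hx, hh hx]
      simp only [Function.update_self]
      exact ⟨(hq x hx).1.symm, (hp x hx).2.symm, (hp x hx).1.symm, (hq x hx).2⟩
    · intro x hx y hy
      obtain rfl : y = v := by simpa using hy
      rw [ht hx, hh hx]
      simp only [Function.update_self]
      have h1 := hp' x hx
      have h2 := hq' x hx
      unfold Crosses
      rw [G.adj_comm]
      tauto
  refine ⟨D', ?_⟩
  obtain ⟨β', hβ', R⟩ := D'.exists_isNajiSolution
  have bit : ∀ {x y : ZMod 2}, (x = 1 ↔ y = 1) → x = y := by decide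
  have e1 : ∀ u w, u ≠ v → w ≠ v → u ≠ w → β u w = β' u w := by
    intro u w hu hw huw
    have h1 := R.eq_one_iff u trivial w trivial huw
    rw [ht hu, hh hu, hh hw, ← D.eq_one_iff u hu w hw huw] at h1
    exact bit h1.symm
  have e2 : ∀ u, u ≠ v → β u v = β' u v := by
    intro u hu
    have h1 := R.eq_one_iff u trivial v trivial hu
    rw [ht hu, hh hu, Function.update_self] at h1
    rw [hv u hu, h1.2 (hp' u hu)]
  have adj : ∀ y, G.Adj v y → β v y = β' v y := by
    intro y hy
    have h1 := hβ.ns1 v y hy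
    have h2 := hβ'.ns1 v y hy
    have h3 := e2 y hy.ne'
    grind
  have step : ∀ u w, G.Adj u w → (u ≠ v → β v u = β' v u) → w ≠ v → β v w = β' v w := by
    intro u w huw hu hwv
    by_cases h1 : G.Adj v w
    · exact adj w h1
    have huv : u ≠ v := by rintro rfl; exact h1 huw
    by_cases h2 : G.Adj v u
    · have h3 := hβ.ns3 u v w huv huw.ne hwv.symm h2.symm huw h1
      have h4 := hβ'.ns3 u v w huv huw.ne hwv.symm h2.symm huw h1
      have h5 := e2 w hwv
      have h6 := e2 u huv
      have h7 := e1 u w huv hwv huw.ne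
      grind
    · have h3 := hβ.ns2 v u w huv.symm hwv.symm huw.ne huw h2 h1
      have h4 := hβ'.ns2 v u w huv.symm hwv.symm huw.ne huw h2 h1
      have h5 := hu huv
      grind
  have e3 : ∀ w, w ≠ v → β v w = β' v w := by
    intro w
    have hr := (G.reachable_iff_reflTransGen v w).1 (hG.preconnected v w)
    induction hr with
    | refl => exact fun h => absurd rfl h
    | tail _ hadj ih => exact step _ _ hadj ih
  intro u _ w _ huw
  rw [← R.eq_one_iff u trivial w trivial huw]
  by_cases hu : u = v
  · subst hu
    rw [e3 w huw.symm]
  · by_cases hw : w = v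
    · subst hw
      rw [e2 u hu]
    · rw [e1 u w hu hw huw]

theorem exists_realizes_of_connected (n : ℕ) : ∀ {V : Type*} [Finite V] {G : SimpleGraph V}
    {β : V → V → ZMod 2}, Nat.card V = n → G.Connected → G.IsNajiSolution β →
    (∀ a b c d, ¬ G.IsBadClique β a b c d) → (∀ a b c d, ¬ G.IsBadStar β a b c d) →
    ∃ t h : V → ℝ, G.Realizes β Set.univ t h := by
  induction n with
  | zero =>
    intro V _ G β hn hG
    have := hG.nonempty
    exact absurd hn Nat.card_pos.ne'
  | succ n ih =>
    intro V _ G β hn hG hβ hK hS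
    classical
    rcases subsingleton_or_nontrivial V with hV | hV
    · exact ⟨_, _, Realizes.of_subsingleton⟩
    obtain ⟨v, hGv⟩ := hG.exists_connected_induce_compl_singleton_of_finite_nontrivial
    obtain ⟨y, hy⟩ : ∃ y, G.Adj v y := hG.preconnected.exists_adj_of_nontrivial v
    -- Chosen so that every `w ≠ v` gets value 1 at `v`; as `ρ v = 0`, adjacency to `v` plays no
    -- role.
    set ρ : V → ZMod 2 := fun w => if w = v then 0 else β w v + 1 with hρ
    suffices ∃ t h : V → ℝ, G.Realizes (G.switch ρ β) Set.univ t h by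
      obtain ⟨t, h, D⟩ := this
      exact ⟨_, _, D.of_switch⟩
    have hβ' := hβ.switch ρ
    have hK' : ∀ a b c d, ¬ G.IsBadClique (G.switch ρ β) a b c d :=
      fun a b c d hb => hK a b c d hb.of_switch
    have hS' : ∀ a b c d, ¬ G.IsBadStar (G.switch ρ β) a b c d :=
      fun a b c d hb => hS a b c d hb.of_switch
    have hv : ∀ w, w ≠ v → G.switch ρ β w v = 1 := by
      intro w hw
      simp only [switch, hρ, hw, if_true, if_false, ite_self, add_zero]
      grind
    generalize G.switch ρ β = γ at *
    have hcard : Nat.card ({v}ᶜ : Set V) = n := by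
      rw [Nat.card_coe_set_eq, Set.ncard_compl, Set.ncard_singleton, hn, Nat.add_sub_cancel]
    obtain ⟨t₀, h₀, D₀⟩ := ih hcard hGv (hβ'.induce _) (fun a b c d hb => hK' _ _ _ _ hb.of_induce)
      (fun a b c d hb => hS' _ _ _ _ hb.of_induce)
    obtain ⟨t, h, D⟩ := D₀.of_induce
    have hE : (t '' {v}ᶜ ∪ h '' {v}ᶜ).Finite := (Set.toFinite _).union (Set.toFinite _)
    obtain ⟨p, hpE, hp⟩ := D.exists_leftOf hβ' hK' hS' hv ⟨y, hy⟩ hE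
    -- Reversing `v` and its neighbours keeps all values at `v` equal to 1. A point left of all the
    -- reversed chords is, for the original ones, right of the neighbours and left of the others: a
    -- place for the tail of `v`.
    set σ : V → ZMod 2 := fun w => if w = v ∨ G.Adj v w then 1 else 0 with hσ
    have hKσ : ∀ a b c d, ¬ G.IsBadClique (G.switch σ γ) a b c d :=
      fun a b c d hb => hK' a b c d hb.of_switch
    have hSσ : ∀ a b c d, ¬ G.IsBadStar (G.switch σ γ) a b c d :=
      fun a b c d hb => hS' a b c d hb.of_switch
    have hvσ : ∀ w, w ≠ v → G.switch σ γ w v = 1 := by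
      intro w hw
      by_cases hadj : G.Adj v w
      · simp only [switch, hσ, hv w hw, hadj, hadj.symm, or_true, true_or, if_true]
        decide
      · have : ¬ G.Adj w v := fun h => hadj h.symm
        simp [switch, hσ, hv w hw, hadj, this, hw]
    have Dσ : G.Realizes (G.switch σ γ) {v}ᶜ _ _ :=
      Realizes.of_switch (ρ := σ) (t := t) (h := h) (by rwa [switch_switch])
    obtain ⟨q, hqE, hq⟩ := Dσ.exists_leftOf (hβ'.switch σ) hKσ hSσ hvσ ⟨y, hy⟩ hE
    have hp1 : ∀ w, w ≠ v → p ≠ t w ∧ p ≠ h w := fun w hw =>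
      ⟨fun e => hpE (Or.inl ⟨w, hw, e.symm⟩), fun e => hpE (Or.inr ⟨w, hw, e.symm⟩)⟩
    have hq1 : ∀ w, w ≠ v → q ≠ t w ∧ q ≠ h w := fun w hw =>
      ⟨fun e => hqE (Or.inl ⟨w, hw, e.symm⟩), fun e => hqE (Or.inr ⟨w, hw, e.symm⟩)⟩
    have hq2 : ∀ w, w ≠ v → (LeftOf (t w) (h w) q ↔ ¬ G.Adj v w) := by
      intro w hw
      have h1 := hq w hw
      by_cases hadj : G.Adj v w
      · simp only [hσ, hadj, or_true, if_true, one_ne_zero, if_false] at h1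
        rw [leftOf_swap (by
          have := D.t_ne_h w hw w hw
          have := hq1 w hw
          simp; tauto)] at h1
        tauto
      · have hσw : σ w = 0 := by simp [hσ, hw, hadj]
        simp only [hσw, if_true] at h1
        exact iff_of_true h1 hadj
    refine ⟨_, _, D.insert hG hβ' hv ?_ hp1 hq1 hp hq2⟩
    -- The two points differ because `v` has a neighbour, which separates them.
    rintro rfl
    exact (hq2 y hy.ne').1 (hp y hy.ne') hy

theorem IsNajiSolution.exists_isDrawing (n : ℕ) : ∀ {V : Type*} [Finite V] {G : SimpleGraph V}
    {β : V → V → ZMod 2}, Nat.card V = n → G.IsNajiSolution β →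
    ∃ t h : V → ℝ, G.IsDrawing Set.univ t h := by
  induction n using Nat.strong_induction_on with
  | _ n ih =>
    intro V _ G β hn hβ
    have small : ∀ (S : Set V) (z : V), z ∉ S → ∃ t h : V → ℝ, G.IsDrawing S t h := by
      intro S z hz
      obtain ⟨t, h, D⟩ := ih (Nat.card S) (hn ▸ Finite.card_subtype_lt hz) rfl (hβ.induce S)
      obtain ⟨t', h', -, -, D'⟩ := D.of_induce
      exact ⟨t', h', D'⟩
    have split : ∀ X : Set V, ∀ a b c d, a ≠ b → c ≠ d → a ∈ X → b ∈ X → c ∉ X → d ∉ X →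
        G.IsRankOneCut X → ∃ t h : V → ℝ, G.IsDrawing Set.univ t h := by
      intro X a b c d hab hcd ha hb hc hd hX
      obtain ⟨x₀, hx₀, y₀, hy₀, hadj⟩ := hX.exists_markers ha hc
      -- Two vertices on each side ensure that a side with one marker added still omits a vertex, so
      -- the induction applies.
      obtain ⟨z, hz⟩ : ∃ z, z ∉ Insert.insert y₀ X := by
        by_cases h : c = y₀
        · exact ⟨d, by rintro (rfl | h'); exacts [hcd h, hd h']⟩
        · exact ⟨c, by rintro (rfl | h'); exacts [h rfl, hc h']⟩
      obtain ⟨z', hz'⟩ : ∃ z', z' ∉ Insert.insert x₀ Xᶜ := by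
        by_cases h : a = x₀
        · exact ⟨b, by rintro (rfl | h'); exacts [hab h, h' hb]⟩
        · exact ⟨a, by rintro (rfl | h'); exacts [h rfl, h' ha]⟩
      obtain ⟨t₁, h₁, D₁⟩ := small _ z hz
      obtain ⟨t₂, h₂, D₂⟩ := small _ z' hz'
      exact exists_isDrawing_of_split hx₀ hy₀ hadj D₁ D₂
    rcases isEmpty_or_nonempty V with hV | hV
    · exact ⟨_, _, (Realizes.of_subsingleton (β := β)).toIsDrawing⟩
    by_cases hG : G.Connected
    · by_cases hK : ∃ a b c d, G.IsBadClique β a b c d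
      · obtain ⟨a, b, c, d, hK⟩ := hK
        obtain ⟨X, ha, hb, hc, hd, hX⟩ := hK.exists_isRankOneCut hβ
        exact split X a b c d hK.ab.ne hK.cd.ne ha hb hc hd hX
      by_cases hS : ∃ a b c d, G.IsBadStar β a b c d
      · obtain ⟨a, b, c, d, hS⟩ := hS
        obtain ⟨X, ha, hb, hc, hd, hX⟩ := hS.exists_isRankOneCut hβ
        exact split X a b c d hS.yp.ne hS.ne_qr ha hb hc hd hX
      push Not at hK hS
      obtain ⟨t, h, D⟩ := exists_realizes_of_connected n hn hG hβ hK hS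
      exact ⟨t, h, D.toIsDrawing⟩
    · obtain ⟨u, w, huw⟩ : ∃ u w, ¬ G.Reachable u w := by
        by_contra hcon
        push Not at hcon
        exact hG ⟨hcon⟩
      obtain ⟨t₁, h₁, D₁⟩ := small {x | G.Reachable u x} w huw
      obtain ⟨t₂, h₂, D₂⟩ := small {x | G.Reachable u x}ᶜ u (fun h => h (Reachable.refl u))
      exact exists_isDrawing_of_not_adj
        (fun x hx y hy hadj => hy (Reachable.trans hx hadj.reachable)) D₁ D₂

end SimpleGraph

theorem mainTheorem1 {V : Type*} [Finite V] (G : SimpleGraph V) :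
    G.IsCircleGraph ↔ ∃ β : V → V → ZMod 2, G.IsNajiSolution β := by
  constructor
  · intro hG
    obtain ⟨t, h, D⟩ := SimpleGraph.exists_isDrawing_of_isCircleGraph hG
    obtain ⟨β, hβ, -⟩ := D.exists_isNajiSolution
    exact ⟨β, hβ⟩
  · rintro ⟨β, hβ⟩
    obtain ⟨t, h, D⟩ := hβ.exists_isDrawing _ rfl
    exact D.isCircleGraph
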